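/- Let $f(x)=\frac{\sin x}{x}$ (with $f(0)=1$). Let $R>0$, $0<h\le\pi$ and $N\in\mathbb N$ be such that $2R=(N-1)h$, and let $x_t=-R+(t-1)h$ for $t=1,\dots,N$, so that $x_1=-R$ and $x_N=R$. Let $d\in\mathbb R$, $\sigma>0$, $n\ge 2$, and let $\mu^*=\sum_{j=1}^n a_j^*\delta_{y_j^*}$ with nonzero real amplitudes $a_j^*$ and $-d\le y_1^*<\dots<y_n^*\le d$. Put $m^*_{\min}=\min_j|a_j^*|$, $d^*_{\min}=\min_{i\ne j}|y_i^*-y_j^*|$, $\mathrm{SRF}=\pi/d^*_{\min}$, and let $M\ge\sum_{j}|a_j^*|$. The measurements are $$\mathbf Y(x_t)=\sum_{j=1}^n a_j^*f(x_t-y_j^*)+\mathbf W(x_t),\qquad t=1,\dots,N,\qquad \mathbf W(x)=\frac1{2\pi}\int_{-\infty}^{\infty}w(\omega)e^{i\omega x}\,d\omega,$$ where $w\in L^2(\mathbb R;\mathbb C)$, $w(\omega)=0$ for $|\omega|>1$, and $\|w\|_2\le\sqrt{2\pi}\,\sigma$. A discrete measure $\mu=\sum_{j=1}^k a_j\delta_{y_j}$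 with real amplitudes and distinct points $y_j$ is called $(d,\sigma,M)$-admissible if $y_j\in[-d,d]$ for all $j$, $\sum_j|a_j|\le M$ and $$\sqrt h\,\Big(\sum_{t=1}^N\Big|\sum_{j=1}^k a_jf(x_t-y_j)-\mathbf Y(x_t)\Big|^2\Big)^{1/2}\le\sigma.$$ For $s\ge1$ let $\mathbf H(s)$ be the $N\times s$ matrix with entries $\sqrt{2r+1}\,f^{(r)}(x_t)$, $1\le t\le N$, $0\le r\le s-1$, and let $\sigma_{\min}(s)$ be the minimum singular value of $\sqrt h\,\mathbf H(s)$, i.e. the square root of the smallest eigenvalue of $h\,\mathbf H(s)^T\mathbf H(s)$. Let $$s^*=\min\Big\{l\in\{0,1,2,\dots\}:\ \frac{d^l}{l!\sqrt{2l+1}}\le\frac{\sigma}{2e^d\sqrt\pi\,M}\Big\}.$$ Assume that $s^*\ge1$, that $\sigma_{\min}(s^*)>0$, and that $$d^*_{\min}\ \ge\ 6.24\,(1+d)\Big(\frac{3}{\sigma_{\min}(s^*)}\,\frac{\sigma}{m^*_{\min}}\Big)^{\frac1{2n-1}}.$$ If $\mu=\sum_{j=1}^n a_j\delta_{y_j}$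 with $-d\le y_1<\dots<y_n\le d$ is $(d,\sigma,M)$-admissible, then $$|y_i-y_i^*|<\frac{d^*_{\min}}2,\qquad i=1,\dots,n,$$ and moreover $$|y_i-y_i^*|<C(n,d)\,\mathrm{SRF}^{2n-2}\,\frac{3\sigma}{\sigma_{\min}(s^*)\,m^*_{\min}},\quad i=1,\dots,n,\qquad C(n,d)=\frac{7.73\sqrt{4n-1}\,(2n-1)(4+4d)^{2n-1}}{4e\,\pi^{2n-\frac12}}.$$ -/

import Mathlib

open MeasureTheory
open scoped BigOperators

namespace Deconvolution

/-- The sample points `x_t = -R + (t - 1) h`, `t = 1, …, N` (indexed here from `0`). -/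
noncomputable def samplePoint (R h : ℝ) {N : ℕ} (t : Fin N) : ℝ :=
  -R + (t : ℕ) * h

/-- The convolution `(μ * f)(x) = ∑ j, a j * f (x - y j)` of the discrete measure
`μ = ∑ j, a j • δ_{y j}` with the point spread function `f x = sin x / x`
(with `f 0 = 1`). -/
noncomputable def convPSF {k : ℕ} (a y : Fin k → ℝ) (x : ℝ) : ℝ :=
  ∑ j, a j * Real.sinc (x - y j)

/-- The total variation norm of `∑ j, a j • δ_{y j}` with distinct points `y j`. -/
noncomputable def tvNorm {k : ℕ} (a : Fin k → ℝ) : ℝ :=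
  ∑ j, |a j|

/-- The minimal amplitude. -/
noncomputable def minAmp {k : ℕ} (a : Fin k → ℝ) : ℝ :=
  ⨅ j, |a j|

/-- The minimal separation `min_{i ≠ j} |y i - y j|`. -/
noncomputable def minSep {k : ℕ} (y : Fin k → ℝ) : ℝ :=
  ⨅ p : {p : Fin k × Fin k // p.1 ≠ p.2}, |y p.1.1 - y p.1.2|

/-- `w` is the spectrum of an admitted noise of level `σ`: it is square integrable, vanishes
outside `[-1, 1]`, and `‖w‖₂ ≤ √(2π) σ`. -/
structure IsNoiseSpectrum (σ : ℝ) (w : ℝ → ℂ) : Prop where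
  memLp : MemLp w 2 volume
  bandlimited : ∀ ω : ℝ, 1 < |ω| → w ω = 0
  norm_le : √(∫ ω, ‖w ω‖ ^ 2) ≤ √(2 * Real.pi) * σ

/-- The noise `W(x) = (1 / 2π) ∫ w(ω) e^{iωx} dω` with spectrum `w`. -/
noncomputable def noise (w : ℝ → ℂ) (x : ℝ) : ℂ :=
  (1 / (2 * Real.pi) : ℂ) * ∫ ω : ℝ, w ω * Complex.exp (Complex.I * ω * x)

/-- The measurement vector `Y(x_t) = (μ * f)(x_t) + W(x_t)`. -/
noncomputable def measurement (R h : ℝ) (N : ℕ) {k : ℕ} (a y : Fin k → ℝ) (w : ℝ → ℂ) :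
    EuclideanSpace ℂ (Fin N) :=
  WithLp.toLp 2 fun t =>
    ((convPSF a y (samplePoint R h t) : ℝ) : ℂ) + noise w (samplePoint R h t)

/-- The noiseless image vector `[μ * f]`. -/
noncomputable def imageVec (R h : ℝ) (N : ℕ) {k : ℕ} (a y : Fin k → ℝ) :
    EuclideanSpace ℂ (Fin N) :=
  WithLp.toLp 2 fun t => ((convPSF a y (samplePoint R h t) : ℝ) : ℂ)

/-- `∑ j, a j • δ_{y j}` is a `(d, σ, M)`-admissible discrete measure for the image `Y`. -/
structure IsAdmissible (R h : ℝ) {N : ℕ} (d σ M : ℝ) (Y : EuclideanSpace ℂ (Fin N))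
    {k : ℕ} (a y : Fin k → ℝ) : Prop where
  support_subset : ∀ j, y j ∈ Set.Icc (-d) d
  tvNorm_le : tvNorm a ≤ M
  residual_le : √h * ‖imageVec R h N a y - Y‖ ≤ σ

/-- The multipole matrix `H(s) = (h_0, …, h_{s-1})`, whose columns are the multipoles
`h_r = √(2r+1) (f^{(r)}(x_1), …, f^{(r)}(x_N))ᵀ`. -/
noncomputable def multipoleMatrix (R h : ℝ) (N s : ℕ) : Matrix (Fin N) (Fin s) ℝ :=
  Matrix.of fun t r =>
    √(2 * ((r : ℕ) : ℝ) + 1) * iteratedDeriv (r : ℕ) Real.sinc (samplePoint R h t)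

/-- The minimum singular value `σ_min(s)` of `√h H(s)`, that is, the square root of the least
of the `s` eigenvalues of `h H(s)ᵀ H(s)`. Mathlib lists singular values from index `0` in
decreasing order, so the last of the `s` values has index `s - 1`. The value is `0` if
`N < s` or `s = 0`. -/
noncomputable def sigmaMin (R h : ℝ) (N s : ℕ) : ℝ :=
  (Matrix.toEuclideanLin (√h • multipoleMatrix R h N s)).singularValues (s - 1)

/-- The number `s*` of multipoles,
`min {l ∈ ℕ : d^l / (l! √(2l+1)) ≤ σ / (2 e^d √π M)}`. -/
noncomputable def sStar (d σ M : ℝ) : ℕ :=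
  sInf {l : ℕ | d ^ l / ((l.factorial : ℝ) * √(2 * (l : ℝ) + 1)) ≤
    σ / (2 * Real.exp d * √Real.pi * M)}

/-- The super-resolution factor: the Rayleigh limit `π` over the minimal separation. -/
noncomputable def SRF {k : ℕ} (y : Fin k → ℝ) : ℝ :=
  Real.pi / minSep y

/-- The constant
`C(n, d) = 7.73 √(4n-1) (2n-1) (4+4d)^{2n-1} / (4 e π^{2n-1/2})`. -/
noncomputable def stabConst (n : ℕ) (d : ℝ) : ℝ :=
  7.73 * √(4 * (n : ℝ) - 1) * (2 * (n : ℝ) - 1) * (4 + 4 * d) ^ (2 * n - 1) /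
    (4 * Real.exp 1 * Real.pi ^ (2 * (n : ℝ) - 1 / 2))

end Deconvolution

open Deconvolution

/-! The difference of the two measures is an atomic measure on `[-d, d]` of mass at most `2M`.
Expanding its image in derivatives of `sinc` makes its moments the coefficients of a vector hit by
the multipole matrix. Since `h ≤ π`, the sampled exponentials are orthogonal on `[-π/h, π/h]`, an
interval containing the band. Bessel's inequality then bounds both the sampled noise and the sampled
Taylor remainder by `σ`, the latter by the choice of `s*`. With the residual this totals `3σ`, and
dividing by `σ_min(s*)` bounds the moments of order below `s*` (`abs_moment_sub_le`). The separation
condition forces `s* ≥ 2n` (`two_mul_le_of_separation`), so all moments up to order `2n - 1` are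
available.

Testing against the polynomial that vanishes at all of the `2n` listed atoms except one true atom
shows that the node polynomial of `y` is small at every true atom
(`abs_mul_prod_sub_le_of_moments`). By Lagrange interpolation its quotient by the node polynomial of
`yStar` is `1` plus an error below `1` at distance at least `D / 2` from the true atoms. Hence it
changes sign around each of them, and the ordering matches roots with atoms
(`abs_sub_lt_half_of_prod_le`). Once the atoms are matched, the other factors of the small product
are bounded below by multiples of `D`, which leaves a bound on the single factor `|yStar l - y l|`
(`near_of_moments`). -/

/-! ### Lower bound by the least singular value -/

/-- The last of the `s` singular values of a map on an `s`-dimensional space bounds the map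
from below. -/
theorem LinearMap.singularValues_mul_norm_le {E F : Type*}
    [NormedAddCommGroup E] [InnerProductSpace ℝ E] [FiniteDimensional ℝ E]
    [NormedAddCommGroup F] [InnerProductSpace ℝ F] [FiniteDimensional ℝ F]
    (T : E →ₗ[ℝ] F) {s : ℕ} (hs : Module.finrank ℝ E = s) (v : E) :
    T.singularValues (s - 1) * ‖v‖ ≤ ‖T v‖ := by
  have hS := T.isSymmetric_adjoint_comp_self
  set b := hS.eigenvectorBasis hs
  have hTv : ‖T v‖ ^ 2 = ∑ i, hS.eigenvalues hs i * b.repr v i ^ 2 := by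
    rw [← real_inner_self_eq_norm_sq, ← LinearMap.adjoint_inner_left, ← LinearMap.comp_apply,
      ← b.sum_inner_mul_inner]
    refine Finset.sum_congr rfl fun i _ => ?_
    have h1 := hS.eigenvectorBasis_apply_self_apply hs v i
    rw [b.repr_apply_apply] at h1
    rw [real_inner_comm, ← b.repr_apply_apply v i]
    rw [OrthonormalBasis.repr_apply_apply] at h1 ⊢
    simp only [RCLike.ofReal_real_eq_id, _root_.id] at h1
    rw [h1]
    simp only [b]
    ring
  have hv : ‖v‖ ^ 2 = ∑ i, b.repr v i ^ 2 := by
    rw [← b.repr.norm_map v, EuclideanSpace.norm_sq_eq]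
    simp
  refine le_of_sq_le_sq ?_ (norm_nonneg _)
  rw [mul_pow, hTv, hv, Finset.mul_sum]
  refine Finset.sum_le_sum fun i _ => mul_le_mul_of_nonneg_right ?_ (sq_nonneg _)
  rw [← T.sq_singularValues_fin hs]
  exact pow_le_pow_left₀ (T.singularValues_nonneg _) (T.singularValues_antitone (by omega)) 2

namespace Deconvolution

/-! ### Bessel's inequality for samples -/

theorem memLp_exp_restrict (L x : ℝ) (c : ℂ) :
    MemLp (fun ω : ℝ => c * Complex.exp (-(Complex.I * ω * x))) 2
      (volume.restrict (Set.Ioc (-L) L)) := by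
  refine MemLp.of_bound (by fun_prop) ‖c‖ (Filter.Eventually.of_forall fun ω => ?_)
  rw [norm_mul, show -(Complex.I * ω * x) = ((-(ω * x) : ℝ) : ℂ) * Complex.I by push_cast; ring,
    Complex.norm_exp_ofReal_mul_I, mul_one]

/-- The interval has length `2π / h`, a whole number of periods, so the antiderivative agrees at
both ends. -/
theorem integral_exp_eq_zero {h : ℝ} (hh : 0 < h) {k : ℤ} (hk : k ≠ 0) :
    ∫ ω in (-(Real.pi / h))..(Real.pi / h), Complex.exp (Complex.I * (k * h) * ω) = 0 := by
  have hc : Complex.I * (k * h) ≠ 0 := by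
    simp [hk, hh.ne']
  have hh' : (h : ℂ) ≠ 0 := by exact_mod_cast hh.ne'
  rw [integral_exp_mul_complex hc]
  have e1 : Complex.exp (Complex.I * (k * h) * ((Real.pi / h : ℝ) : ℂ)) =
      Complex.exp (Complex.I * (k * h) * ((-(Real.pi / h) : ℝ) : ℂ)) := by
    rw [Complex.exp_eq_exp_iff_exists_int]
    refine ⟨k, ?_⟩
    push_cast
    field_simp
    ring
  rw [e1, sub_self, zero_div]

/-- Bessel's inequality for equispaced samples of a band-limited function. -/
theorem mul_sum_norm_noise_sq_le {N : ℕ} {R h : ℝ} (hh : 0 < h) (hhpi : h ≤ Real.pi)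
    {g : ℝ → ℂ} (hg : MemLp g 2 volume) (hband : ∀ ω : ℝ, 1 < |ω| → g ω = 0) :
    h * ∑ t : Fin N, ‖noise g (samplePoint R h t)‖ ^ 2 ≤
      1 / (2 * Real.pi) * ∫ ω, ‖g ω‖ ^ 2 := by
  have hpi := Real.pi_pos
  set L := Real.pi / h with hL
  -- This is where `h ≤ π` enters: the band `[-1, 1]` fits in one period `[-L, L]`.
  have hL1 : 1 ≤ L := (one_le_div hh).mpr hhpi
  set ν := (volume : Measure ℝ).restrict (Set.Ioc (-L) L)
  -- Normalises the exponentials on an interval of length `2π / h`.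
  set c : ℂ := ((√(h / (2 * Real.pi)) : ℝ) : ℂ) with hc
  have hcc : c * c = ((h / (2 * Real.pi) : ℝ) : ℂ) := by
    rw [hc, ← Complex.ofReal_mul, Real.mul_self_sqrt (by positivity)]
  have hconj : (starRingEnd ℂ) c = c := Complex.conj_ofReal _
  have he : ∀ t : Fin N, MemLp (fun ω : ℝ =>
      c * Complex.exp (-(Complex.I * ω * (samplePoint R h t : ℝ)))) 2 ν := fun t =>
    memLp_exp_restrict L _ c
  have hgν : MemLp g 2 ν := hg.restrict _
  have hce : ∀ (x ω : ℝ), (starRingEnd ℂ) (c * Complex.exp (-(Complex.I * ω * x))) =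
      c * Complex.exp (Complex.I * ω * x) := by
    intro x ω
    rw [map_mul, hconj, ← Complex.exp_conj]
    simp
  have hinner : ∀ (t : Fin N) (u : ℝ → ℂ) (hu : MemLp u 2 ν),
      inner ℂ ((he t).toLp _) (hu.toLp u) =
        c * ∫ ω in Set.Ioc (-L) L, u ω * Complex.exp (Complex.I * ω * (samplePoint R h t : ℝ)) := by
    intro t u hu
    rw [L2.inner_def, ← integral_const_mul]
    refine integral_congr_ae ?_
    filter_upwards [(he t).coeFn_toLp, hu.coeFn_toLp] with ω h1 h2
    rw [h1, h2, RCLike.inner_apply, hce]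
    ring
  have hortho : Orthonormal ℂ fun t : Fin N => (he t).toLp _ := by
    rw [orthonormal_iff_ite]
    intro t t'
    rw [hinner t _ (he t'), ← intervalIntegral.integral_of_le (by linarith)]
    have : ∀ ω : ℝ, c * Complex.exp (-(Complex.I * ω * (samplePoint R h t' : ℝ))) *
        Complex.exp (Complex.I * ω * (samplePoint R h t : ℝ)) =
        c * Complex.exp (Complex.I * ((((t : ℕ) : ℤ) - ((t' : ℕ) : ℤ) : ℤ) * h) * ω) := by
      intro ω
      rw [mul_assoc, ← Complex.exp_add]
      congr 2
      simp only [samplePoint]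
      push_cast
      ring
    simp only [this]
    rw [intervalIntegral.integral_const_mul, ← mul_assoc, hcc]
    split_ifs with htt
    · subst htt
      simp only [sub_self, Int.cast_zero, zero_mul, mul_zero, Complex.exp_zero,
        intervalIntegral.integral_const, hL]
      rw [Complex.real_smul, mul_one, ← Complex.ofReal_mul, ← Complex.ofReal_one]
      congr 1
      field_simp
      ring
    · have hne : ((t : ℕ) : ℤ) - ((t' : ℕ) : ℤ) ≠ 0 := by
        intro h0
        exact htt (Fin.ext (by omega))
      rw [integral_exp_eq_zero hh hne, mul_zero]
  have hB := hortho.sum_inner_products_le (s := Finset.univ) (hgν.toLp g)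
  have hnorm : ‖hgν.toLp g‖ ^ 2 ≤ ∫ ω, ‖g ω‖ ^ 2 := by
    rw [@norm_sq_eq_re_inner ℂ, L2.inner_def]
    have : ∫ ω, inner ℂ ((hgν.toLp g) ω) ((hgν.toLp g) ω) ∂ν =
        ((∫ ω in Set.Ioc (-L) L, ‖g ω‖ ^ 2 : ℝ) : ℂ) := by
      rw [← integral_complex_ofReal]
      refine integral_congr_ae ?_
      filter_upwards [hgν.coeFn_toLp] with ω h1
      rw [h1, inner_self_eq_norm_sq_to_K]
      simp
    rw [this]
    exact setIntegral_le_integral ((memLp_two_iff_integrable_sq_norm hg.1).mp hg)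
      (Filter.Eventually.of_forall fun ω => by positivity)
  have hfull : ∀ x : ℝ, ∫ ω in Set.Ioc (-L) L, g ω * Complex.exp (Complex.I * ω * x) =
      ∫ ω, g ω * Complex.exp (Complex.I * ω * x) := by
    intro x
    rw [← integral_Icc_eq_integral_Ioc]
    refine setIntegral_eq_integral_of_forall_compl_eq_zero fun ω hω => ?_
    rw [hband ω, zero_mul]
    rw [Set.mem_Icc, ← abs_le] at hω
    linarith [not_le.mp hω]
  have hterm : ∀ t : Fin N, ‖inner ℂ ((he t).toLp _) (hgν.toLp g)‖ ^ 2 =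
      2 * Real.pi * (h * ‖noise g (samplePoint R h t)‖ ^ 2) := by
    intro t
    rw [hinner, hfull, noise, norm_mul, norm_mul, mul_pow, mul_pow, hc, Complex.norm_real,
      Real.norm_eq_abs, sq_abs, Real.sq_sqrt (by positivity)]
    have : ‖(1 / (2 * Real.pi) : ℂ)‖ = 1 / (2 * Real.pi) := by
      rw [show (1 / (2 * Real.pi) : ℂ) = ((1 / (2 * Real.pi) : ℝ) : ℂ) by push_cast; rfl,
        Complex.norm_real, Real.norm_of_nonneg (by positivity)]
    rw [this]
    generalize ‖∫ ω : ℝ, g ω * Complex.exp (Complex.I * ω * (samplePoint R h t : ℝ))‖ = q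
    field_simp
  simp only [hterm] at hB
  rw [← Finset.mul_sum, ← Finset.mul_sum] at hB
  have := hB.trans hnorm
  rw [one_div, ← div_eq_inv_mul, le_div_iff₀ (by positivity)]
  linarith

/-! ### Multipole expansion and its remainder -/

/-- Termwise comparison of the shifted series, using `s! r! ≤ (r + s)!`. -/
theorem exp_sub_sum_le_pow_div_factorial_mul_exp {x : ℝ} (hx : 0 ≤ x) (s : ℕ) :
    Real.exp x - ∑ r ∈ Finset.range s, x ^ r / r.factorial ≤
      x ^ s / s.factorial * Real.exp x := by
  have h0 : HasSum (fun r : ℕ => x ^ r / r.factorial) (Real.exp x) := by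
    rw [Real.exp_eq_exp_ℝ]
    exact NormedSpace.expSeries_div_hasSum_exp x
  have h1 := (hasSum_nat_add_iff' s).mpr h0
  refine hasSum_le (fun r => ?_) h1 (h0.mul_left (x ^ s / s.factorial))
  have h2 : ((s.factorial * r.factorial : ℕ) : ℝ) ≤ ((r + s).factorial : ℝ) := by
    rw [add_comm]
    exact_mod_cast Nat.le_of_dvd (Nat.factorial_pos _)
      (Nat.factorial_mul_factorial_dvd_factorial_add s r)
  push_cast at h2
  rw [div_mul_div_comm, pow_add, mul_comm (x ^ r)]
  exact div_le_div_of_nonneg_left (by positivity) (by positivity) h2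

theorem norm_exp_sub_sum_le {w : ℂ} {B : ℝ} (hw : ‖w‖ ≤ B) (s : ℕ) :
    ‖Complex.exp w - ∑ r ∈ Finset.range s, w ^ r / r.factorial‖ ≤
      ‖w‖ ^ s / s.factorial * Real.exp B := by
  refine (Complex.norm_exp_sub_sum_le_exp_norm_sub_sum w s).trans
    ((exp_sub_sum_le_pow_div_factorial_mul_exp (norm_nonneg w) s).trans ?_)
  gcongr

theorem hasDerivAt_integral_pow_mul_exp (r : ℕ) (x : ℝ) :
    HasDerivAt (fun x : ℝ => ∫ ω in (-1 : ℝ)..1,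
        (Complex.I * ω) ^ r * Complex.exp (Complex.I * ω * x))
      (∫ ω in (-1 : ℝ)..1, (Complex.I * ω) ^ (r + 1) * Complex.exp (Complex.I * ω * x)) x := by
  refine (intervalIntegral.hasDerivAt_integral_of_dominated_loc_of_deriv_le (s := Set.univ)
    (F := fun (x ω : ℝ) => (Complex.I * ω) ^ r * Complex.exp (Complex.I * ω * x))
    (F' := fun (x ω : ℝ) => (Complex.I * ω) ^ (r + 1) * Complex.exp (Complex.I * ω * x))
    (bound := fun _ => 1) Filter.univ_mem ?_ ?_ ?_ ?_ ?_ ?_).2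
  · exact Filter.Eventually.of_forall fun x => by fun_prop
  · exact Continuous.intervalIntegrable (by fun_prop) _ _
  · fun_prop
  · refine Filter.Eventually.of_forall fun ω hω x _ => ?_
    rw [Set.uIoc_of_le (by norm_num)] at hω
    rw [norm_mul, norm_pow, norm_mul, Complex.norm_I, one_mul, Complex.norm_real,
      show Complex.I * ω * x = ((ω * x : ℝ) : ℂ) * Complex.I by push_cast; ring,
      Complex.norm_exp_ofReal_mul_I, mul_one]
    exact pow_le_one₀ (norm_nonneg _) (abs_le.mpr ⟨hω.1.le, hω.2⟩)
  · simp
  · refine Filter.Eventually.of_forall fun ω _ x _ => ?_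
    have h1 : HasDerivAt (fun x : ℝ => Complex.I * ω * (x : ℂ)) (Complex.I * ω) x := by
      simpa using (Complex.ofRealCLM.hasDerivAt (x := x)).const_mul (Complex.I * (ω : ℂ))
    exact (h1.cexp.const_mul ((Complex.I * ω) ^ r)).congr_deriv (by ring)

theorem ofReal_sinc_eq_integral (x : ℝ) :
    ((Real.sinc x : ℝ) : ℂ) =
      1 / 2 * ∫ ω in (-1 : ℝ)..1, Complex.exp (Complex.I * ω * x) := by
  by_cases hx : x = 0
  · subst hx
    simp
    norm_num
  · have hx' : (x : ℂ) ≠ 0 := by exact_mod_cast hx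
    have hc : Complex.I * x ≠ 0 := mul_ne_zero Complex.I_ne_zero hx'
    have : ∀ ω : ℝ, Complex.exp (Complex.I * ω * x) = Complex.exp (Complex.I * x * ω) :=
      fun ω => by ring_nf
    simp only [this]
    rw [integral_exp_mul_complex hc, Real.sinc_of_ne_zero hx]
    push_cast
    rw [Complex.sin]
    field_simp
    rw [Complex.I_sq]
    ring_nf

/-- The derivatives of `sinc` as Fourier integrals over the band. -/
theorem ofReal_iteratedDeriv_sinc (r : ℕ) (x : ℝ) :
    ((iteratedDeriv r Real.sinc x : ℝ) : ℂ) =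
      1 / 2 * ∫ ω in (-1 : ℝ)..1,
        (Complex.I * ω) ^ r * Complex.exp (Complex.I * ω * x) := by
  induction r generalizing x with
  | zero => simpa using ofReal_sinc_eq_integral x
  | succ r ih =>
    have hd := (hasDerivAt_integral_pow_mul_exp r x).const_mul (1 / 2 : ℂ)
    have heq : (fun x : ℝ => 1 / 2 * ∫ ω in (-1 : ℝ)..1,
        (Complex.I * ω) ^ r * Complex.exp (Complex.I * ω * x)) =
        fun x => ((iteratedDeriv r Real.sinc x : ℝ) : ℂ) := funext fun x => (ih x).symm
    rw [heq] at hd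
    have hre := Complex.reCLM.hasFDerivAt.comp_hasDerivAt x hd
    have him := Complex.imCLM.hasFDerivAt.comp_hasDerivAt x hd
    simp only [Function.comp_def, Complex.reCLM_apply, Complex.imCLM_apply, Complex.ofReal_re,
      Complex.ofReal_im] at hre him
    -- The differentiated function is real-valued, so the imaginary part of its derivative vanishes.
    have him0 := him.unique (hasDerivAt_const x (0 : ℝ))
    rw [iteratedDeriv_succ, hre.deriv]
    apply Complex.ext
    · simp
    · rw [him0]
      simp

/-- The spectrum of the remainder of the multipole expansion of `∑ j, b j * sinc (x - z j)`. -/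
noncomputable def tailSpectrum {ι : Type*} [Fintype ι] (b z : ι → ℝ) (s : ℕ) : ℝ → ℂ :=
  (Set.Icc (-1 : ℝ) 1).indicator fun ω => Real.pi * ∑ j, (b j : ℂ) *
    (Complex.exp (-(Complex.I * ω * z j)) -
      ∑ r ∈ Finset.range s, (-(Complex.I * ω * z j)) ^ r / r.factorial)

/-- Taylor expansion in the frequency domain: each power of `Iω` becomes a derivative of `sinc`.
Writing the remainder as a `noise` lets the same Bessel inequality serve for it. -/
theorem noise_tailSpectrum {ι : Type*} [Fintype ι] (b z : ι → ℝ) (s : ℕ) (x : ℝ) :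
    noise (tailSpectrum b z s) x =
      ((∑ j, b j * Real.sinc (x - z j) - ∑ r ∈ Finset.range s,
        (∑ j, b j * (-z j) ^ r) / r.factorial * iteratedDeriv r Real.sinc x : ℝ) : ℂ) := by
  have hpi : (Real.pi : ℂ) ≠ 0 := by exact_mod_cast Real.pi_ne_zero
  have h1 : ∫ ω : ℝ, tailSpectrum b z s ω * Complex.exp (Complex.I * ω * x) =
      ∫ ω in (-1 : ℝ)..1, Real.pi * (∑ j, (b j : ℂ) *
        (Complex.exp (Complex.I * ω * ((x - z j : ℝ) : ℂ)) -
          ∑ r ∈ Finset.range s, ((-z j : ℝ) : ℂ) ^ r / r.factorial *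
            ((Complex.I * ω) ^ r * Complex.exp (Complex.I * ω * x)))) := by
    rw [intervalIntegral.integral_of_le (by norm_num), ← integral_Icc_eq_integral_Ioc,
      ← integral_indicator measurableSet_Icc]
    refine integral_congr_ae (Filter.Eventually.of_forall fun ω => ?_)
    simp only [tailSpectrum, Set.indicator]
    split_ifs
    · rw [mul_assoc, Finset.sum_mul]
      congr 1
      refine Finset.sum_congr rfl fun j _ => ?_
      rw [mul_assoc, sub_mul, ← Complex.exp_add, Finset.sum_mul]
      congr 2
      · congr 1
        push_cast
        ring
      · refine Finset.sum_congr rfl fun r _ => ?_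
        rw [show -(Complex.I * ω * z j) = ((-z j : ℝ) : ℂ) * (Complex.I * ω) by push_cast; ring,
          mul_pow]
        ring
    · simp
  rw [noise, h1, intervalIntegral.integral_const_mul, intervalIntegral.integral_finsetSum]
  swap
  · exact fun j _ => Continuous.intervalIntegrable (by fun_prop) _ _
  have h2 : ∀ j, ∫ ω in (-1 : ℝ)..1, (b j : ℂ) *
        (Complex.exp (Complex.I * ω * ((x - z j : ℝ) : ℂ)) -
          ∑ r ∈ Finset.range s, ((-z j : ℝ) : ℂ) ^ r / r.factorial *
            ((Complex.I * ω) ^ r * Complex.exp (Complex.I * ω * x))) =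
      2 * ((b j * (Real.sinc (x - z j) - ∑ r ∈ Finset.range s,
        (-z j) ^ r / r.factorial * iteratedDeriv r Real.sinc x) : ℝ) : ℂ) := by
    intro j
    rw [intervalIntegral.integral_const_mul, intervalIntegral.integral_sub,
      intervalIntegral.integral_finsetSum]
    · simp only [intervalIntegral.integral_const_mul]
      push_cast
      simp only [ofReal_iteratedDeriv_sinc, ofReal_sinc_eq_integral]
      push_cast
      rw [mul_left_comm]
      congr 1
      rw [mul_sub, Finset.mul_sum]
      congr 1
      · ring
      · refine Finset.sum_congr rfl fun r _ => ?_
        ring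
    · exact fun j _ => Continuous.intervalIntegrable (by fun_prop) _ _
    · exact Continuous.intervalIntegrable (by fun_prop) _ _
    · exact Continuous.intervalIntegrable (by fun_prop) _ _
  simp only [h2]
  rw [← Finset.mul_sum, ← Complex.ofReal_sum]
  have h3 : ∑ j, b j * (Real.sinc (x - z j) - ∑ r ∈ Finset.range s,
        (-z j) ^ r / r.factorial * iteratedDeriv r Real.sinc x) =
      ∑ j, b j * Real.sinc (x - z j) - ∑ r ∈ Finset.range s,
        (∑ j, b j * (-z j) ^ r) / r.factorial * iteratedDeriv r Real.sinc x := by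
    simp only [mul_sub, Finset.sum_sub_distrib, Finset.mul_sum, Finset.sum_div, Finset.sum_mul]
    congr 1
    rw [Finset.sum_comm]
    refine Finset.sum_congr rfl fun r _ => Finset.sum_congr rfl fun j _ => ?_
    ring
  rw [h3]
  field_simp

/-- The factor `|ω| ^ s` is retained because integrating its square over the band yields the `√(2s +
1)` in the definition of `sStar`. -/
theorem norm_tailSpectrum_le {ι : Type*} [Fintype ι] {b z : ι → ℝ} (s : ℕ) {d A : ℝ}
    (hd : 0 ≤ d) (hz : ∀ j, |z j| ≤ d) (hA : ∑ j, |b j| ≤ A) (ω : ℝ) (hω : |ω| ≤ 1) :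
    ‖tailSpectrum b z s ω‖ ≤ Real.pi * (A * (d ^ s / s.factorial * Real.exp d)) * |ω| ^ s := by
  rw [tailSpectrum, Set.indicator_of_mem (by rwa [Set.mem_Icc, ← abs_le]), norm_mul,
    Complex.norm_real, Real.norm_of_nonneg Real.pi_pos.le, mul_assoc]
  refine mul_le_mul_of_nonneg_left ?_ Real.pi_pos.le
  have hterm : ∀ j, ‖(b j : ℂ) * (Complex.exp (-(Complex.I * ω * z j)) -
      ∑ r ∈ Finset.range s, (-(Complex.I * ω * z j)) ^ r / r.factorial)‖ ≤
      |b j| * (d ^ s / s.factorial * Real.exp d * |ω| ^ s) := by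
    intro j
    have hn : ‖-(Complex.I * ω * z j)‖ = |ω| * |z j| := by
      simp
    rw [norm_mul, Complex.norm_real, Real.norm_eq_abs]
    refine mul_le_mul_of_nonneg_left ?_ (abs_nonneg _)
    refine (norm_exp_sub_sum_le (B := d) ?_ s).trans ?_
    · rw [hn]
      calc _ ≤ 1 * d := mul_le_mul hω (hz j) (abs_nonneg _) (by norm_num)
        _ = d := one_mul d
    · rw [hn]
      calc _ ≤ (|ω| * d) ^ s / s.factorial * Real.exp d := by
            gcongr
            exact hz j
        _ = _ := by rw [mul_pow]; ring
  calc _ ≤ ∑ j, |b j| * (d ^ s / s.factorial * Real.exp d * |ω| ^ s) :=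
        norm_sum_le_of_le _ fun j _ => hterm j
    _ = (∑ j, |b j|) * (d ^ s / s.factorial * Real.exp d * |ω| ^ s) := by
        rw [Finset.sum_mul]
    _ ≤ A * (d ^ s / s.factorial * Real.exp d * |ω| ^ s) := by gcongr
    _ = _ := by ring

theorem memLp_tailSpectrum {ι : Type*} [Fintype ι] (b z : ι → ℝ) (s : ℕ) :
    MemLp (tailSpectrum b z s) 2 volume := by
  rw [tailSpectrum, memLp_indicator_iff_restrict measurableSet_Icc]
  set F : ℝ → ℂ := fun ω => Real.pi * ∑ j, (b j : ℂ) *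
    (Complex.exp (-(Complex.I * ω * z j)) -
      ∑ r ∈ Finset.range s, (-(Complex.I * ω * z j)) ^ r / r.factorial)
  have hF : Continuous F := by fun_prop
  obtain ⟨K, hK⟩ := isCompact_Icc.exists_bound_of_continuousOn (s := Set.Icc (-1 : ℝ) 1)
    hF.continuousOn
  exact MemLp.of_bound hF.aestronglyMeasurable K (ae_restrict_of_forall_mem measurableSet_Icc hK)

theorem integral_norm_tailSpectrum_sq_le {ι : Type*} [Fintype ι] {b z : ι → ℝ} (s : ℕ)
    {d A : ℝ} (hd : 0 ≤ d) (hz : ∀ j, |z j| ≤ d) (hA : ∑ j, |b j| ≤ A) :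
    ∫ ω, ‖tailSpectrum b z s ω‖ ^ 2 ≤
      (Real.pi * (A * (d ^ s / s.factorial * Real.exp d))) ^ 2 * (2 / (2 * s + 1)) := by
  set K := Real.pi * (A * (d ^ s / s.factorial * Real.exp d))
  have h0 : ∫ ω, ‖tailSpectrum b z s ω‖ ^ 2 =
      ∫ ω in Set.Icc (-1 : ℝ) 1, ‖tailSpectrum b z s ω‖ ^ 2 := by
    refine (setIntegral_eq_integral_of_forall_compl_eq_zero fun ω hω => ?_).symm
    rw [tailSpectrum, Set.indicator_of_notMem hω]
    simp
  have h1 : ∫ ω in Set.Icc (-1 : ℝ) 1, ‖tailSpectrum b z s ω‖ ^ 2 ≤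
      ∫ ω in Set.Icc (-1 : ℝ) 1, K ^ 2 * ω ^ (2 * s) := by
    refine setIntegral_mono_on ?_ ?_ measurableSet_Icc fun ω hω => ?_
    · exact ((memLp_two_iff_integrable_sq_norm (memLp_tailSpectrum b z s).1).mp
        (memLp_tailSpectrum b z s)).integrableOn
    · exact (Continuous.continuousOn (by fun_prop)).integrableOn_Icc
    · have h2 := norm_tailSpectrum_le s hd hz hA ω (abs_le.mpr hω)
      calc _ ≤ (K * |ω| ^ s) ^ 2 := pow_le_pow_left₀ (norm_nonneg _) h2 2
        _ = _ := by rw [mul_pow, ← pow_mul, mul_comm s 2, pow_mul, sq_abs, ← pow_mul]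
  rw [h0]
  refine h1.trans (le_of_eq ?_)
  rw [integral_Icc_eq_integral_Ioc, ← intervalIntegral.integral_of_le (by norm_num),
    intervalIntegral.integral_const_mul, integral_pow]
  rw [Odd.neg_one_pow ⟨s, rfl⟩]
  push_cast
  norm_num

/-- The samples of the remainder of the multipole expansion. -/
theorem mul_sum_multipole_tail_sq_le {N : ℕ} {R h : ℝ} (hh : 0 < h) (hhpi : h ≤ Real.pi)
    {ι : Type*} [Fintype ι] {b z : ι → ℝ} (s : ℕ) {d A : ℝ} (hd : 0 ≤ d)
    (hz : ∀ j, |z j| ≤ d) (hA : ∑ j, |b j| ≤ A) :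
    h * ∑ t : Fin N, (∑ j, b j * Real.sinc (samplePoint R h t - z j) - ∑ r ∈ Finset.range s,
        (∑ j, b j * (-z j) ^ r) / r.factorial *
          iteratedDeriv r Real.sinc (samplePoint R h t)) ^ 2 ≤
      (A * Real.exp d * √Real.pi * (d ^ s / (s.factorial * √(2 * s + 1)))) ^ 2 := by
  have hB := mul_sum_norm_noise_sq_le (N := N) (R := R) hh hhpi (memLp_tailSpectrum b z s)
    (fun ω hω => by
      rw [tailSpectrum, Set.indicator_of_notMem]
      rw [Set.mem_Icc, ← abs_le]
      exact not_le.mpr hω)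
  simp only [noise_tailSpectrum, Complex.norm_real, Real.norm_eq_abs, sq_abs] at hB
  refine hB.trans ?_
  have hpi := Real.pi_pos
  calc _ ≤ 1 / (2 * Real.pi) *
        ((Real.pi * (A * (d ^ s / s.factorial * Real.exp d))) ^ 2 * (2 / (2 * s + 1))) := by
        gcongr
        exact integral_norm_tailSpectrum_sq_le s hd hz hA
    _ = _ := by
        simp only [mul_pow, div_pow]
        rw [Real.sq_sqrt hpi.le, Real.sq_sqrt (by positivity)]
        field_simp

/-! ### From moments to node polynomials -/

/-- A bound on the moments up to order `K` controls the integral of a product of at most `K`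
linear factors. -/
theorem abs_sum_mul_prod_sub_le {ι κ : Type*} [Fintype ι] (b z : ι → ℝ)
    (u : κ → ℝ) {d B : ℝ} {K : ℕ} (hu : ∀ i, |u i| ≤ d)
    (hB : ∀ r ≤ K, |∑ j, b j * z j ^ r| ≤ B) (S : Finset κ) :
    ∀ r, S.card + r ≤ K →
      |∑ j, b j * ((∏ i ∈ S, (z j - u i)) * z j ^ r)| ≤ (1 + d) ^ S.card * B := by
  classical
  induction S using Finset.induction_on with
  | empty => intro r hr; simpa using hB r (by simpa using hr)
  | insert c S hc ih =>
    intro r hr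
    rw [Finset.card_insert_of_notMem hc] at hr ⊢
    have h1 := ih (r + 1) (by omega)
    have h2 := ih r (by omega)
    -- A new factor `z - u c` raises the moment order by one and subtracts at most `d` times the old
    -- quantity, so it costs `1 + d`.
    have hsplit : ∑ j, b j * ((∏ i ∈ insert c S, (z j - u i)) * z j ^ r) =
        ∑ j, b j * ((∏ i ∈ S, (z j - u i)) * z j ^ (r + 1)) -
          u c * ∑ j, b j * ((∏ i ∈ S, (z j - u i)) * z j ^ r) := by
      rw [Finset.mul_sum, ← Finset.sum_sub_distrib]
      refine Finset.sum_congr rfl fun j _ => ?_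
      rw [Finset.prod_insert hc]
      ring
    rw [hsplit]
    calc _ ≤ _ := abs_sub _ _
      _ ≤ (1 + d) ^ S.card * B + d * ((1 + d) ^ S.card * B) := by
        rw [abs_mul]
        exact add_le_add h1 (mul_le_mul (hu c) h2 (abs_nonneg _) ((abs_nonneg _).trans (hu c)))
      _ = _ := by ring

/-- If the moments of order at most `2n - 1` of two measures with `n` atoms are close, then the
atoms of the first measure nearly annihilate the node polynomial of the second. -/
theorem abs_mul_prod_sub_le_of_moments {n : ℕ} (hn : 1 ≤ n) (a y aStar yStar : Fin n → ℝ)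
    {d B : ℝ} (hy : ∀ i, |y i| ≤ d) (hyStar : ∀ i, |yStar i| ≤ d)
    (hB : ∀ r ≤ 2 * n - 1, |∑ j, a j * y j ^ r - ∑ j, aStar j * yStar j ^ r| ≤ B) (l : Fin n) :
    |aStar l| * ((∏ i, |yStar l - y i|) * ∏ i ∈ Finset.univ.erase l, |yStar l - yStar i|) ≤
      (1 + d) ^ (2 * n - 1) * B := by
  classical
  -- The test polynomial has a factor for each of the `2n` listed atoms except `yStar l`, so only
  -- the term of that atom survives.
  have key := abs_sum_mul_prod_sub_le (Sum.elim a fun i => -aStar i) (Sum.elim y yStar)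
    (Sum.elim y yStar) (d := d) (B := B) (K := 2 * n - 1)
    (by rintro (i | i); exacts [hy i, hyStar i])
    (by
      intro r hr
      simpa [Fintype.sum_sum_type, ← sub_eq_add_neg] using hB r hr)
    (Finset.univ.erase (Sum.inr l)) 0
    (by simp; omega)
  have hcard : (Finset.univ.erase (Sum.inr l : Fin n ⊕ Fin n)).card = 2 * n - 1 := by
    simp; omega
  rw [hcard] at key
  refine le_trans (le_of_eq ?_) key
  rw [Finset.sum_eq_single (Sum.inr l)]
  · have : Finset.univ.erase (Sum.inr l : Fin n ⊕ Fin n) =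
        Finset.univ.disjSum (Finset.univ.erase l) := by
      ext (i | i) <;> simp
    rw [this, Finset.prod_disjSum]
    simp [abs_mul, Finset.abs_prod]
  · intro j _ hj
    rw [Finset.prod_eq_zero (i := j) (by simpa using hj) (by simp)]
    simp
  · simp

/-! ### Locating the roots near the true atoms -/

open Polynomial in
/-- The quotient of two monic real polynomials with `n` prescribed roots each, in barycentric
form. -/
theorem prod_sub_eq_prod_sub_mul {n : ℕ} (y u : Fin n → ℝ) (hu : Function.Injective u) {x : ℝ}
    (hx : ∀ i, x ≠ u i) :
    ∏ i, (x - y i) = (∏ i, (x - u i)) * (1 + ∑ l,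
      Lagrange.nodalWeight Finset.univ u l * (x - u l)⁻¹ * ∏ i, (u l - y i)) := by
  set q := Lagrange.nodal Finset.univ y
  set p := Lagrange.nodal Finset.univ u
  have hlt : (q - p).degree < (Finset.univ : Finset (Fin n)).card := by
    have := degree_sub_lt_left (p := q) (q := p)
      (by rw [Lagrange.degree_nodal, Lagrange.degree_nodal]) Lagrange.nodal_ne_zero
      (by rw [Lagrange.nodal_monic.leadingCoeff, Lagrange.nodal_monic.leadingCoeff])
    rwa [Lagrange.degree_nodal] at this
  -- The difference of two monic polynomials of degree `n` has degree below `n`, so it equals its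
  -- interpolant at the nodes `u`.
  have h := congrArg (eval x) (Lagrange.eq_interpolate (v := u) hu.injOn hlt)
  rw [Lagrange.eval_interpolate_not_at_node _ fun i _ => hx i] at h
  simp only [eval_sub, q, p, Lagrange.eval_nodal_at_node (Finset.mem_univ _), sub_zero] at h
  simp only [Lagrange.eval_nodal] at h
  rw [mul_add, ← h]
  ring

theorem mul_sub_le_of_le_abs_sub {n : ℕ} {u : Fin n → ℝ} (hu : StrictMono u) {D : ℝ}
    (hD : ∀ i j, i ≠ j → D ≤ |u i - u j|) {i j : Fin n} (hij : i ≤ j) :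
    D * ((j : ℕ) - (i : ℕ) : ℝ) ≤ u j - u i := by
  obtain ⟨i, hi⟩ := i
  obtain ⟨j, hj⟩ := j
  simp only [Fin.mk_le_mk] at hij
  induction j, hij using Nat.le_induction with
  | base => simp
  | succ k hk ih =>
    have h1 := ih (by omega)
    have hlt : u ⟨k, by omega⟩ < u ⟨k + 1, hj⟩ := hu (by simp)
    have h2 := hD ⟨k + 1, hj⟩ ⟨k, by omega⟩ (by simp)
    rw [abs_of_pos (by linarith)] at h2
    push_cast at h1 ⊢
    nlinarith

theorem mul_dist_le_abs_sub {n : ℕ} {u : Fin n → ℝ} (hu : StrictMono u) {D : ℝ}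
    (hD : ∀ i j, i ≠ j → D ≤ |u i - u j|) (i j : Fin n) :
    D * (Nat.dist i j : ℝ) ≤ |u i - u j| := by
  rcases le_total i j with h | h
  · rw [Nat.dist_eq_sub_of_le h, Nat.cast_sub h, abs_sub_comm]
    exact (mul_sub_le_of_le_abs_sub hu hD h).trans (le_abs_self _)
  · rw [Nat.dist_eq_sub_of_le_right h, Nat.cast_sub h]
    exact (mul_sub_le_of_le_abs_sub hu hD h).trans (le_abs_self _)

/-- If the node polynomial of `y` is small at every node `u l`, then it has a zero near every
node, and `y` follows `u` in order. -/
theorem abs_sub_lt_half_of_prod_le {n : ℕ} {y u : Fin n → ℝ} (hy : StrictMono y)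
    (hu : StrictMono u) {D E : ℝ} (hD0 : 0 < D) (hD : ∀ i j, i ≠ j → D ≤ |u i - u j|)
    (hE : ∀ l, (∏ i, |u l - y i|) * ∏ i ∈ Finset.univ.erase l, |u l - u i| ≤ E)
    (hsmall : ∑ l, 2 * E / (D * (∏ i ∈ Finset.univ.erase l, |u l - u i|) ^ 2) < 1) (l : Fin n) :
    |y l - u l| < D / 2 := by
  have hV : ∀ l, 0 < ∏ i ∈ Finset.univ.erase l, |u l - u i| := fun l =>
    Finset.prod_pos fun i hi => lt_of_lt_of_le hD0 (hD l i (Finset.ne_of_mem_erase hi).symm)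
  -- Away from the nodes the quotient of the two polynomials is positive, so they have the same
  -- sign.
  have hpos : ∀ x, (∀ i, D / 2 ≤ |x - u i|) → 0 < (∏ i, (x - y i)) * ∏ i, (x - u i) := by
    intro x hx
    have hne : ∀ i, x ≠ u i := fun i h => by
      have := hx i
      rw [h, sub_self, abs_zero] at this
      linarith
    rw [prod_sub_eq_prod_sub_mul y u hu.injective hne]
    have hω : ∏ i, (x - u i) ≠ 0 := Finset.prod_ne_zero_iff.mpr fun i _ => sub_ne_zero.mpr (hne i)
    have hsum : |∑ l, Lagrange.nodalWeight Finset.univ u l * (x - u l)⁻¹ *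
        ∏ i, (u l - y i)| < 1 := by
      refine lt_of_le_of_lt (Finset.abs_sum_le_sum_abs _ _) (lt_of_le_of_lt ?_ hsmall)
      refine Finset.sum_le_sum fun l _ => ?_
      rw [abs_mul, abs_mul, Lagrange.nodalWeight, Finset.abs_prod, Finset.abs_prod, abs_inv]
      simp only [abs_inv]
      rw [Finset.prod_inv_distrib]
      have h1 : |x - u l|⁻¹ ≤ 2 / D := by
        rw [← inv_div]
        exact inv_anti₀ (by positivity) (hx l)
      have h2 : ∏ i, |u l - y i| ≤ E / ∏ i ∈ Finset.univ.erase l, |u l - u i| :=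
        (le_div_iff₀ (hV l)).mpr (hE l)
      have h3 : 0 < (∏ i ∈ Finset.univ.erase l, |u l - u i|)⁻¹ := inv_pos.mpr (hV l)
      calc _ ≤ (∏ i ∈ Finset.univ.erase l, |u l - u i|)⁻¹ * (2 / D) *
            (E / ∏ i ∈ Finset.univ.erase l, |u l - u i|) :=
            mul_le_mul (mul_le_mul_of_nonneg_left h1 h3.le) h2
              (Finset.prod_nonneg fun _ _ => abs_nonneg _) (by positivity)
        _ = _ := by
          have := (hV l).ne'
          field_simp
    have := (abs_lt.mp hsum).1
    have h4 : 0 < (∏ i, (x - u i)) ^ 2 := by positivity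
    nlinarith
  have hroot : ∀ l, ∃ i, |y i - u l| < D / 2 := by
    intro l
    have hdist : ∀ i, i ≠ l → D / 2 ≤ |u l - D / 2 - u i| ∧ D / 2 ≤ |u l + D / 2 - u i| ∧
        0 < (u l - D / 2 - u i) * (u l + D / 2 - u i) := by
      intro i hi
      have := hD l i hi.symm
      rcases le_abs'.mp this with h | h
      · refine ⟨le_abs'.mpr (Or.inl (by linarith)), le_abs'.mpr (Or.inl (by linarith)), ?_⟩
        nlinarith
      · refine ⟨le_abs'.mpr (Or.inr (by linarith)), le_abs'.mpr (Or.inr (by linarith)), ?_⟩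
        nlinarith
    have hm := hpos (u l - D / 2) fun i => by
      by_cases hi : i = l
      · subst hi
        rw [abs_sub_comm]
        exact le_abs'.mpr (Or.inr (by linarith))
      · exact (hdist i hi).1
    have hp := hpos (u l + D / 2) fun i => by
      by_cases hi : i = l
      · subst hi
        exact le_abs'.mpr (Or.inr (by linarith))
      · exact (hdist i hi).2.1
    -- Across this interval only the factor with index `l` changes sign.
    have hω : (∏ i, (u l - D / 2 - u i)) * ∏ i, (u l + D / 2 - u i) < 0 := by
      rw [← Finset.prod_mul_distrib, ← Finset.mul_prod_erase _ _ (Finset.mem_univ l)]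
      refine mul_neg_of_neg_of_pos (by nlinarith)
        (Finset.prod_pos fun i hi => (hdist i (Finset.ne_of_mem_erase hi)).2.2)
    have hq : (∏ i, (u l - D / 2 - y i)) * ∏ i, (u l + D / 2 - y i) < 0 := by
      by_contra hcon
      push Not at hcon
      have := mul_pos hm hp
      nlinarith
    have hcont : Continuous fun x => ∏ i, (x - y i) := by fun_prop
    have hle : u l - D / 2 ≤ u l + D / 2 := by linarith
    have hz : ∃ x ∈ Set.Ioo (u l - D / 2) (u l + D / 2), ∏ i, (x - y i) = 0 := by
      rcases mul_neg_iff.mp hq with ⟨h1, h2⟩ | ⟨h1, h2⟩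
      · exact intermediate_value_Ioo' hle hcont.continuousOn ⟨h2, h1⟩
      · exact intermediate_value_Ioo hle hcont.continuousOn ⟨h1, h2⟩
    obtain ⟨x, hx, hx0⟩ := hz
    obtain ⟨i, -, hi⟩ := Finset.prod_eq_zero_iff.mp hx0
    refine ⟨i, ?_⟩
    rw [← sub_eq_zero.mp hi, abs_lt]
    constructor <;> linarith [hx.1, hx.2]
  choose τ hτ using hroot
  -- The open intervals of radius `D / 2` around the nodes are disjoint and ordered, hence so are
  -- the chosen roots; a strictly monotone self-map of `Fin n` is the identity.
  have hmono : StrictMono τ := by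
    intro i j hij
    have h1 := hD j i hij.ne'
    rw [abs_of_pos (sub_pos.mpr (hu hij))] at h1
    have h2 := abs_lt.mp (hτ i)
    have h3 := abs_lt.mp (hτ j)
    exact hy.lt_iff_lt.mp (by linarith)
  have hid := congrFun hmono.eq_id l
  have := hτ l
  rwa [hid] at this

/-! ### Products of distances and numerical constants -/

/-- Index distances from `l` run through `1, …, l` on the left and `1, …, n - 1 - l` on the right.
-/
theorem prod_erase_dist {n : ℕ} (l : Fin n) (F : ℕ → ℝ) :
    ∏ i ∈ Finset.univ.erase l, F (Nat.dist l i) =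
      (∏ k ∈ Finset.range l, F (k + 1)) * ∏ k ∈ Finset.range (n - 1 - l), F (k + 1) := by
  have h1 : ∏ i ∈ Finset.univ.erase l, F (Nat.dist l i) =
      ∏ i ∈ (Finset.range n).erase l, F (Nat.dist l i) := by
    refine Finset.prod_bij (fun i _ => (i : ℕ)) ?_ ?_ ?_ ?_
    · intro i hi
      simpa [Fin.val_inj] using hi
    · intro i _ j _ h
      exact Fin.ext h
    · intro i hi
      simp only [Finset.mem_erase, Finset.mem_range] at hi
      exact ⟨⟨i, hi.2⟩, by simpa [Fin.ext_iff] using hi.1, rfl⟩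
    · intros; rfl
  have h2 : (Finset.range n).erase l = Finset.range l ∪ Finset.Ico (l + 1) n := by
    ext k
    simp
    have := l.2
    omega
  have h3 : Disjoint (Finset.range l) (Finset.Ico ((l : ℕ) + 1) n) := by
    rw [Finset.disjoint_left]
    intro k
    simp
    omega
  rw [h1, h2, Finset.prod_union h3]
  congr 1
  · rw [← Finset.prod_range_reflect]
    refine Finset.prod_congr rfl fun k hk => ?_
    rw [Finset.mem_range] at hk
    rw [Nat.dist_eq_sub_of_le_right (by omega)]
    congr 1
    omega
  · rw [Finset.prod_Ico_eq_prod_range]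
    refine Finset.prod_congr (by congr 1; omega) fun k _ => ?_
    rw [Nat.dist_eq_sub_of_le (by omega)]
    congr 1
    omega

theorem mul_prod_range_sub_half (p : ℕ) :
    4 ^ p * (p.factorial : ℝ) * ∏ k ∈ Finset.range p, (((k + 1 : ℕ) : ℝ) - 1 / 2) =
      ((2 * p).factorial : ℝ) := by
  induction p with
  | zero => simp
  | succ p ih =>
    rw [Finset.prod_range_succ, show 2 * (p + 1) = 2 * p + 1 + 1 by ring, Nat.factorial_succ,
      Nat.factorial_succ, Nat.factorial_succ]
    push_cast
    rw [← ih]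
    push_cast
    ring

theorem prod_range_cast_add_one (p : ℕ) :
    ∏ k ∈ Finset.range p, ((k + 1 : ℕ) : ℝ) = (p.factorial : ℝ) := by
  rw [← Nat.cast_prod, Finset.prod_range_add_one_eq_factorial]

/-- Lower bound for the product of the distances from one node to the others. -/
theorem pow_mul_factorial_le_prod {n : ℕ} {u : Fin n → ℝ} (hu : StrictMono u) {D : ℝ}
    (hD0 : 0 < D) (hD : ∀ i j, i ≠ j → D ≤ |u i - u j|) (l : Fin n) :
    D ^ (n - 1) * ((l : ℕ).factorial * (n - 1 - l).factorial : ℝ) ≤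
      ∏ i ∈ Finset.univ.erase l, |u l - u i| := by
  rw [← prod_range_cast_add_one, ← prod_range_cast_add_one,
    ← prod_erase_dist l fun k => (k : ℝ)]
  calc _ = ∏ i ∈ Finset.univ.erase l, D * (Nat.dist l i : ℝ) := by
        rw [Finset.prod_mul_distrib]
        simp
    _ ≤ _ := Finset.prod_le_prod (fun _ _ => by positivity)
        fun i _ => mul_dist_le_abs_sub hu hD l i

/-- Lower bound for the product of the distances from one node to points that are close to the
others. -/
theorem pow_mul_factorial_le_prod_of_near {n : ℕ} {y u : Fin n → ℝ} (hu : StrictMono u) {D : ℝ}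
    (hD0 : 0 < D) (hD : ∀ i j, i ≠ j → D ≤ |u i - u j|) (hyu : ∀ i, |y i - u i| ≤ D / 2)
    (l : Fin n) :
    D ^ (n - 1) * ((2 * (l : ℕ)).factorial * (2 * (n - 1 - l)).factorial : ℝ) ≤
      4 ^ (n - 1) * ((l : ℕ).factorial * (n - 1 - l).factorial : ℝ) *
        ∏ i ∈ Finset.univ.erase l, |u l - y i| := by
  -- Moving each point by at most `D / 2` lowers its distance `D * k` to at least `D * (k - 1 / 2)`;
  -- products of half-integers then become factorials of even numbers.
  have key : D ^ (n - 1) * ((∏ k ∈ Finset.range l, (((k + 1 : ℕ) : ℝ) - 1 / 2)) *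
      ∏ k ∈ Finset.range (n - 1 - l), (((k + 1 : ℕ) : ℝ) - 1 / 2)) ≤
      ∏ i ∈ Finset.univ.erase l, |u l - y i| := by
    rw [← prod_erase_dist l fun k => (k : ℝ) - 1 / 2]
    have hcard : D ^ (n - 1) = ∏ i ∈ Finset.univ.erase l, D := by simp
    rw [hcard, ← Finset.prod_mul_distrib]
    refine Finset.prod_le_prod (fun i hi => ?_) fun i _ => ?_
    · have h1 : 1 ≤ Nat.dist l i := by
        have h2 := Finset.ne_of_mem_erase hi
        have : (i : ℕ) ≠ l := fun h => h2 (Fin.ext h)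
        exact Nat.dist_pos_of_ne this.symm
      have : (1 : ℝ) ≤ (Nat.dist l i : ℝ) := by exact_mod_cast h1
      exact mul_nonneg hD0.le (by linarith)
    · have h1 := mul_dist_le_abs_sub hu hD l i
      have h2 := abs_sub_le (u l) (y i) (u i)
      have h3 := hyu i
      linarith
  rw [← mul_prod_range_sub_half, ← mul_prod_range_sub_half]
  have h4 : (4 : ℝ) ^ (n - 1) = 4 ^ (l : ℕ) * 4 ^ (n - 1 - l : ℕ) := by
    rw [← pow_add]
    congr 1
    omega
  rw [h4]
  have hc : (0 : ℝ) ≤ 4 ^ (l : ℕ) * 4 ^ (n - 1 - l : ℕ) *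
      ((l : ℕ).factorial * (n - 1 - l).factorial : ℝ) := by positivity
  calc _ = 4 ^ (l : ℕ) * 4 ^ (n - 1 - l : ℕ) *
      ((l : ℕ).factorial * (n - 1 - l).factorial : ℝ) * _ := by ring
    _ ≤ _ := mul_le_mul_of_nonneg_left key hc

/-- After multiplication by `(n - 1)!²` the terms are squared binomial coefficients, which sum to
the central one. -/
theorem sum_inv_sq_factorial {n : ℕ} (hn : 1 ≤ n) :
    ∑ l : Fin n, 1 / ((l : ℕ).factorial * (n - 1 - l).factorial : ℝ) ^ 2 =
      (Nat.centralBinom (n - 1) : ℝ) / ((n - 1).factorial : ℝ) ^ 2 := by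
  obtain ⟨m, rfl⟩ : ∃ m, n = m + 1 := ⟨n - 1, by omega⟩
  rw [Nat.add_sub_cancel, Nat.centralBinom_eq_two_mul_choose, ← Nat.sum_range_choose_sq,
    Fin.sum_univ_eq_sum_range
      (fun l => 1 / ((l : ℕ).factorial * (m - l).factorial : ℝ) ^ 2) (m + 1)]
  push_cast
  rw [Finset.sum_div]
  refine Finset.sum_congr rfl fun l hl => ?_
  rw [Nat.cast_choose ℝ (by simpa [Nat.lt_succ_iff] using hl)]
  have := Nat.factorial_ne_zero m
  field_simp

theorem two_mul_centralBinom_le {m : ℕ} (hm : 1 ≤ m) : 2 * Nat.centralBinom m ≤ 4 ^ m := by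
  induction m, hm using Nat.le_induction with
  | base => decide
  | succ k hk ih =>
    have h := Nat.succ_mul_centralBinom_succ k
    have : (k + 1) * (2 * Nat.centralBinom (k + 1)) ≤ (k + 1) * 4 ^ (k + 1) := by
      rw [pow_succ]
      nlinarith [Nat.centralBinom_pos k]
    exact Nat.le_of_mul_le_mul_left this (by omega)

theorem two_mul_add_one_mul_le (m : ℕ) : (2 * m + 1) * (2 * m + 2) ≤ 12 * 2 ^ m := by
  rcases Nat.lt_or_ge m 2 with h | h
  · interval_cases m <;> norm_num
  · induction m, h using Nat.le_induction with
    | base => norm_num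
    | succ k hk ih =>
      rw [pow_succ]
      nlinarith

/-- The left side is at most a quadratic polynomial in `m = n - 1` times `16 ^ m`. Absorbing the
polynomial into `12 * 2 ^ m` gives growth `32 ^ m`, below `(6.24 ^ 2) ^ m`. -/
theorem separation_constant_bound {n : ℕ} (hn : 2 ≤ n) :
    2 * ((2 * n - 1).factorial * √(4 * (n : ℝ) - 1)) *
      ((Nat.centralBinom (n - 1) : ℝ) / ((n - 1).factorial : ℝ) ^ 2) < 6.24 ^ (2 * n - 1) := by
  obtain ⟨m, rfl⟩ : ∃ m, n = m + 1 := ⟨n - 1, by omega⟩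
  rw [Nat.add_sub_cancel, show 2 * (m + 1) - 1 = 2 * m + 1 by omega, Nat.factorial_succ]
  have hcb : ((2 * m).factorial : ℝ) = Nat.centralBinom m * (m.factorial : ℝ) ^ 2 := by
    have := Nat.choose_mul_factorial_mul_factorial (n := 2 * m) (k := m) (by omega)
    rw [← Nat.centralBinom_eq_two_mul_choose, show 2 * m - m = m by omega] at this
    rw [← this]
    push_cast
    ring
  have hs : √(4 * ((m + 1 : ℕ) : ℝ) - 1) ≤ 2 * m + 2 := by
    rw [Real.sqrt_le_left (by positivity)]
    push_cast
    nlinarith [(Nat.cast_nonneg m : (0 : ℝ) ≤ m)]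
  have hc : 2 * (Nat.centralBinom m : ℝ) ≤ 4 ^ m := by
    exact_mod_cast two_mul_centralBinom_le (m := m) (by omega)
  have hc2 : 4 * (Nat.centralBinom m : ℝ) ^ 2 ≤ 16 ^ m := by
    calc 4 * (Nat.centralBinom m : ℝ) ^ 2 = (2 * (Nat.centralBinom m : ℝ)) ^ 2 := by ring
      _ ≤ (4 ^ m) ^ 2 := pow_le_pow_left₀ (by positivity) hc 2
      _ = 16 ^ m := by rw [← pow_mul, mul_comm, pow_mul]; norm_num
  have hp : ((2 * m + 1) * (2 * m + 2) : ℝ) ≤ 12 * 2 ^ m := by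
    exact_mod_cast two_mul_add_one_mul_le m
  have hf : (m.factorial : ℝ) ≠ 0 := by positivity
  calc _ = (2 * m + 1) * √(4 * ((m + 1 : ℕ) : ℝ) - 1) * (4 * (Nat.centralBinom m : ℝ) ^ 2) / 2 := by
        push_cast
        rw [hcb]
        field_simp
        ring
    _ ≤ (2 * m + 1) * (2 * m + 2) * 16 ^ m / 2 := by gcongr
    _ ≤ 12 * 2 ^ m * 16 ^ m / 2 := by gcongr
    _ = 6 * 32 ^ m := by
        rw [show (32 : ℝ) = 2 * 16 by norm_num, mul_pow]
        ring
    _ < 6.24 * 38.9 ^ m := by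
        have : (32 : ℝ) ^ m ≤ 38.9 ^ m := pow_le_pow_left₀ (by norm_num) (by norm_num) m
        have : (0 : ℝ) < 38.9 ^ m := by positivity
        linarith
    _ ≤ 6.24 * (6.24 ^ 2) ^ m := by
        gcongr
        norm_num
    _ = _ := by rw [← pow_mul]; ring

/-! ### Stability of the atoms under moment perturbation -/

/-- Two measures with `n` atoms and nearly equal moments up to order `2n - 1` have nearby atoms,
provided that the atoms of one of them are sufficiently separated. -/
theorem near_of_moments {n : ℕ} (hn : 2 ≤ n) {a y aStar yStar : Fin n → ℝ}
    (hyStar : StrictMono yStar) (hy : StrictMono y) {d D m η : ℝ} (hd : 0 ≤ d) (hD0 : 0 < D)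
    (hD : ∀ i j, i ≠ j → D ≤ |yStar i - yStar j|) (hm : 0 < m) (hma : ∀ j, m ≤ |aStar j|)
    (hη : 0 ≤ η) (hyd : ∀ i, |y i| ≤ d) (hyStard : ∀ i, |yStar i| ≤ d)
    (hmom : ∀ r ≤ 2 * n - 1, |∑ j, a j * y j ^ r - ∑ j, aStar j * yStar j ^ r| ≤
      (2 * n - 1).factorial * √(4 * (n : ℝ) - 1) * η)
    (hsep : η / m ≤ (D / (6.24 * (1 + d))) ^ (2 * n - 1)) :
    (∀ i, |y i - yStar i| < D / 2) ∧
      ∀ i, |y i - yStar i| * D ^ (2 * n - 2) ≤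
        (1 + d) ^ (2 * n - 1) * ((2 * n - 1) * √(4 * (n : ℝ) - 1) * (η / m)) *
          4 ^ (2 * n - 2) / 2 := by
  have hV0 : ∀ l, 0 < ∏ i ∈ Finset.univ.erase l, |yStar l - yStar i| := fun l =>
    Finset.prod_pos fun i hi => lt_of_lt_of_le hD0 (hD l i (Finset.ne_of_mem_erase hi).symm)
  have hP : ∀ l, (∏ i, |yStar l - y i|) * ∏ i ∈ Finset.univ.erase l, |yStar l - yStar i| ≤
      (1 + d) ^ (2 * n - 1) * ((2 * n - 1).factorial * √(4 * (n : ℝ) - 1) * (η / m)) := by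
    intro l
    have h1 := abs_mul_prod_sub_le_of_moments (by omega) a y aStar yStar hyd hyStard hmom l
    have h2 : 0 ≤ (∏ i, |yStar l - y i|) * ∏ i ∈ Finset.univ.erase l, |yStar l - yStar i| :=
      mul_nonneg (Finset.prod_nonneg fun _ _ => abs_nonneg _) (hV0 l).le
    have h3 := (mul_le_mul_of_nonneg_right (hma l) h2).trans h1
    rw [mul_comm, ← le_div_iff₀ hm] at h3
    refine h3.trans (le_of_eq ?_)
    ring
  have hnear : ∀ i, |y i - yStar i| < D / 2 := by
    refine abs_sub_lt_half_of_prod_le hy hyStar hD0 hD hP ?_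
    set E := (1 + d) ^ (2 * n - 1) * ((2 * n - 1).factorial * √(4 * (n : ℝ) - 1) * (η / m))
    have hE0 : 0 ≤ E := by positivity
    -- The factor `1 + d` in the separation condition cancels the cost of the test polynomial.
    have hE : E ≤ (2 * n - 1).factorial * √(4 * (n : ℝ) - 1) * (D / 6.24) ^ (2 * n - 1) := by
      calc E ≤ (1 + d) ^ (2 * n - 1) * ((2 * n - 1).factorial * √(4 * (n : ℝ) - 1) *
            (D / (6.24 * (1 + d))) ^ (2 * n - 1)) := by
            simp only [E]
            gcongr
        _ = _ := by
          have : (1 + d) ^ (2 * n - 1) * (D / (6.24 * (1 + d))) ^ (2 * n - 1) =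
              (D / 6.24) ^ (2 * n - 1) := by
            rw [← mul_pow]
            congr 1
            have : 1 + d ≠ 0 := by positivity
            field_simp
          rw [← this]
          ring
    have hterm : ∀ l : Fin n,
        2 * E / (D * (∏ i ∈ Finset.univ.erase l, |yStar l - yStar i|) ^ 2) ≤
        2 * E / D ^ (2 * n - 1) *
          (1 / ((l : ℕ).factorial * (n - 1 - l).factorial : ℝ) ^ 2) := by
      intro l
      have h1 := pow_mul_factorial_le_prod hyStar hD0 hD l
      have h2 : D ^ (2 * n - 1) * ((l : ℕ).factorial * (n - 1 - l).factorial : ℝ) ^ 2 ≤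
          D * (∏ i ∈ Finset.univ.erase l, |yStar l - yStar i|) ^ 2 := by
        calc _ = D * (D ^ (n - 1) * ((l : ℕ).factorial * (n - 1 - l).factorial : ℝ)) ^ 2 := by
              rw [show 2 * n - 1 = (n - 1) * 2 + 1 by omega, pow_succ, pow_mul]
              ring
          _ ≤ _ := by gcongr
      rw [div_mul_div_comm, mul_one]
      exact div_le_div_of_nonneg_left (by positivity) (by positivity) h2
    refine (Finset.sum_le_sum fun l _ => hterm l).trans_lt ?_
    rw [← Finset.mul_sum, sum_inv_sq_factorial (by omega)]
    have hK := separation_constant_bound hn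
    calc _ ≤ 2 * ((2 * n - 1).factorial * √(4 * (n : ℝ) - 1) * (D / 6.24) ^ (2 * n - 1)) /
          D ^ (2 * n - 1) * ((Nat.centralBinom (n - 1) : ℝ) / ((n - 1).factorial : ℝ) ^ 2) := by
          gcongr
      _ = 2 * ((2 * n - 1).factorial * √(4 * (n : ℝ) - 1)) *
          ((Nat.centralBinom (n - 1) : ℝ) / ((n - 1).factorial : ℝ) ^ 2) /
            6.24 ^ (2 * n - 1) := by
          rw [div_pow]
          field_simp
      _ < 1 := by rwa [div_lt_one (by positivity)]
  refine ⟨hnear, fun l => ?_⟩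
  obtain ⟨k, rfl⟩ : ∃ k, n = k + 1 := ⟨n - 1, by omega⟩
  have h1 := pow_mul_factorial_le_prod hyStar hD0 hD l
  have h2 := pow_mul_factorial_le_prod_of_near hyStar hD0 hD (fun i => (hnear i).le) l
  have h3 := hP l
  -- Isolates `|y l - yStar l|`; the other factors `P` and `V` are bounded below next.
  rw [← Finset.mul_prod_erase _ _ (Finset.mem_univ l), abs_sub_comm] at h3
  set V := ∏ i ∈ Finset.univ.erase l, |yStar l - yStar i|
  set P := ∏ i ∈ Finset.univ.erase l, |yStar l - y i|
  simp only [Nat.add_sub_cancel, show 2 * (k + 1) - 2 = 2 * k by omega,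
    show 2 * (k + 1) - 1 = 2 * k + 1 by omega] at *
  have hlk : (l : ℕ) ≤ k := by omega
  have hPnn : 0 ≤ P := Finset.prod_nonneg fun _ _ => abs_nonneg _
  have h4 : D ^ (2 * k) * ((2 * (l : ℕ)).factorial * (2 * (k - l)).factorial : ℝ) ≤
      4 ^ k * (P * V) := by
    calc _ = D ^ k * (D ^ k * ((2 * (l : ℕ)).factorial * (2 * (k - l)).factorial : ℝ)) := by
          rw [two_mul k, pow_add]
          ring
      _ ≤ D ^ k * (4 ^ k * ((l : ℕ).factorial * (k - l).factorial : ℝ) * P) := by gcongr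
      _ = 4 ^ k * (P * (D ^ k * ((l : ℕ).factorial * (k - l).factorial : ℝ))) := by ring
      _ ≤ _ := by gcongr
  have h5 : ((2 * k).factorial : ℝ) * 2 ≤
      4 ^ k * ((2 * (l : ℕ)).factorial * (2 * (k - l)).factorial : ℝ) := by
    -- `2 * C(2k, 2l) ≤ 4 ^ k` removes the dependence on `l` and supplies the final factor `1 / 2`.
    have h6 := Nat.choose_mul_factorial_mul_factorial (n := 2 * k) (k := 2 * l) (by omega)
    have h7 := Nat.choose_le_centralBinom (2 * l) k
    have h8 := two_mul_centralBinom_le (m := k) (by omega)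
    have h9 : 2 * (2 * k).choose (2 * l) ≤ 4 ^ k := by omega
    rw [show 2 * k - 2 * (l : ℕ) = 2 * (k - l) by omega] at h6
    rw [← h6]
    have h10 : (2 * (2 * k).choose (2 * l) : ℝ) ≤ 4 ^ k := by exact_mod_cast h9
    push_cast
    calc _ = (2 * (2 * k).choose (2 * l) : ℝ) *
        ((2 * (l : ℕ)).factorial * (2 * (k - l)).factorial : ℝ) := by ring
      _ ≤ _ := by gcongr
  have h11 : D ^ (2 * k) * ((2 * k).factorial * 2 : ℝ) ≤ 4 ^ (2 * k) * (P * V) := by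
    calc _ ≤ D ^ (2 * k) *
          (4 ^ k * ((2 * (l : ℕ)).factorial * (2 * (k - l)).factorial : ℝ)) := by gcongr
      _ = 4 ^ k * (D ^ (2 * k) *
          ((2 * (l : ℕ)).factorial * (2 * (k - l)).factorial : ℝ)) := by ring
      _ ≤ 4 ^ k * (4 ^ k * (P * V)) := by gcongr
      _ = _ := by rw [two_mul k, pow_add]; ring
  have h12 : |y l - yStar l| * D ^ (2 * k) * ((2 * k).factorial * 2 : ℝ) ≤
      4 ^ (2 * k) * ((1 + d) ^ (2 * k + 1) *
        ((2 * k + 1).factorial * √(4 * ((k + 1 : ℕ) : ℝ) - 1) * (η / m))) := by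
    calc _ = |y l - yStar l| * (D ^ (2 * k) * ((2 * k).factorial * 2 : ℝ)) := by ring
      _ ≤ |y l - yStar l| * (4 ^ (2 * k) * (P * V)) := by gcongr
      _ = 4 ^ (2 * k) * (|y l - yStar l| * P * V) := by ring
      _ ≤ _ := by gcongr
  rw [Nat.factorial_succ] at h12
  have hf : (0 : ℝ) < (2 * k).factorial := by positivity
  rw [← mul_le_mul_iff_left₀ (show (0 : ℝ) < (2 * k).factorial * 2 by positivity)]
  refine h12.trans (le_of_eq ?_)
  push_cast
  ring

/-! ### Separation and amplitude -/

theorem minSep_le_abs_sub {n : ℕ} (y : Fin n → ℝ) {i j : Fin n} (hij : i ≠ j) :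
    minSep y ≤ |y i - y j| :=
  ciInf_le (Set.finite_range _).bddBelow
    (⟨(i, j), hij⟩ : {p : Fin n × Fin n // p.1 ≠ p.2})

theorem minSep_pos {n : ℕ} (hn : 2 ≤ n) {y : Fin n → ℝ} (hy : Function.Injective y) :
    0 < minSep y := by
  have : Nonempty {p : Fin n × Fin n // p.1 ≠ p.2} :=
    ⟨⟨(⟨0, by omega⟩, ⟨1, by omega⟩), by simp⟩⟩
  obtain ⟨p, hp⟩ := exists_eq_ciInf_of_finite
    (f := fun p : {p : Fin n × Fin n // p.1 ≠ p.2} => |y p.1.1 - y p.1.2|)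
  rw [minSep, ← hp]
  exact abs_pos.mpr (sub_ne_zero.mpr fun h => p.2 (hy h))

theorem minAmp_le_abs {n : ℕ} (a : Fin n → ℝ) (j : Fin n) : minAmp a ≤ |a j| :=
  ciInf_le (Set.finite_range _).bddBelow j

theorem minAmp_pos {n : ℕ} (hn : 0 < n) {a : Fin n → ℝ} (ha : ∀ j, a j ≠ 0) :
    0 < minAmp a := by
  have : Nonempty (Fin n) := ⟨⟨0, hn⟩⟩
  obtain ⟨j, hj⟩ := exists_eq_ciInf_of_finite (f := fun j => |a j|)
  rw [minAmp, ← hj]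
  exact abs_pos.mpr (ha j)

theorem card_mul_minAmp_le_tvNorm {n : ℕ} (a : Fin n → ℝ) : n * minAmp a ≤ tvNorm a := by
  have := Finset.card_nsmul_le_sum Finset.univ (fun j => |a j|) (minAmp a)
    fun j _ => minAmp_le_abs a j
  simpa [tvNorm] using this

/-! ### Moment bounds from the measurements -/

theorem toEuclideanLin_multipoleMatrix_apply (R h : ℝ) (N s : ℕ) (v : Fin s → ℝ) (t : Fin N) :
    Matrix.toEuclideanLin (√h • multipoleMatrix R h N s) (WithLp.toLp 2 v) t =
      √h * ∑ r : Fin s, √(2 * ((r : ℕ) : ℝ) + 1) *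
        iteratedDeriv r Real.sinc (samplePoint R h t) * v r := by
  rw [Matrix.toLpLin_toLp, Matrix.toLin'_apply]
  simp [Matrix.mulVec, dotProduct, multipoleMatrix, Finset.mul_sum, mul_assoc]

theorem sigmaMin_mul_norm_le (R h : ℝ) (N s : ℕ) (v : EuclideanSpace ℝ (Fin s)) :
    sigmaMin R h N s * ‖v‖ ≤ ‖Matrix.toEuclideanLin (√h • multipoleMatrix R h N s) v‖ :=
  LinearMap.singularValues_mul_norm_le _ (by simp) v

theorem sqrt_mul_norm_le_of_sq {N : ℕ} {𝕜 : Type*} [RCLike 𝕜] {h K : ℝ} (hh : 0 ≤ h)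
    (hK : 0 ≤ K) (v : EuclideanSpace 𝕜 (Fin N)) (hv : h * ∑ t, ‖v t‖ ^ 2 ≤ K ^ 2) :
    √h * ‖v‖ ≤ K := by
  refine le_of_sq_le_sq ?_ hK
  rwa [mul_pow, Real.sq_sqrt hh, EuclideanSpace.norm_sq_eq]

theorem pos_of_sigmaMin_pos {R h : ℝ} {N s : ℕ} (hs : 0 < sigmaMin R h N s) : 0 < s := by
  rcases Nat.eq_zero_or_pos s with rfl | h0
  · rw [sigmaMin, LinearMap.singularValues_of_finrank_le _ (by simp)] at hs
    exact absurd hs (lt_irrefl 0)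
  · exact h0

/-- Test on the first basis vector: its image samples `sinc`, which is an order-zero remainder of a
unit atom at `0`. The bound is needed to show `s* ≥ 2n`. -/
theorem sigmaMin_le_sqrt_pi {R h : ℝ} (hh : 0 < h) (hhpi : h ≤ Real.pi) {N s : ℕ} (hs : 0 < s) :
    sigmaMin R h N s ≤ √Real.pi := by
  set v : Fin s → ℝ := Pi.single ⟨0, hs⟩ 1
  have hv : ‖(WithLp.toLp 2 v : EuclideanSpace ℝ (Fin s))‖ = 1 := by
    change ‖EuclideanSpace.single (⟨0, hs⟩ : Fin s) (1 : ℝ)‖ = 1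
    simp
  have h1 := sigmaMin_mul_norm_le R h N s (WithLp.toLp 2 v)
  rw [hv, mul_one] at h1
  refine h1.trans (le_of_sq_le_sq ?_ (Real.sqrt_nonneg _))
  have h2 : ∀ t, Matrix.toEuclideanLin (√h • multipoleMatrix R h N s) (WithLp.toLp 2 v) t =
      √h * Real.sinc (samplePoint R h t) := by
    intro t
    rw [toEuclideanLin_multipoleMatrix_apply, Finset.sum_eq_single ⟨0, hs⟩]
    · simp [v]
    · intro r _ hr
      simp [v, hr]
    · simp
  rw [EuclideanSpace.norm_sq_eq]
  simp only [h2, Real.norm_eq_abs, sq_abs, mul_pow, Real.sq_sqrt hh.le]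
  rw [← Finset.mul_sum]
  have h3 := mul_sum_multipole_tail_sq_le (N := N) (R := R) hh hhpi (ι := Unit)
    (b := fun _ => 1) (z := fun _ => 0) 0 (d := 0) (A := 1) le_rfl (by simp) (by simp)
  simpa using h3

theorem sqrt_mul_norm_noise_le {N : ℕ} {R h σ : ℝ} (hh : 0 < h) (hhpi : h ≤ Real.pi)
    (hσ : 0 ≤ σ) {w : ℝ → ℂ} (hw : IsNoiseSpectrum σ w) :
    √h * ‖(WithLp.toLp 2 fun t => noise w (samplePoint R h t) :
      EuclideanSpace ℂ (Fin N))‖ ≤ σ := by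
  refine sqrt_mul_norm_le_of_sq hh.le hσ _ ?_
  refine (mul_sum_norm_noise_sq_le hh hhpi hw.memLp hw.bandlimited).trans ?_
  have hpi := Real.pi_pos
  have h1 := pow_le_pow_left₀ (Real.sqrt_nonneg _) hw.norm_le 2
  rw [Real.sq_sqrt (integral_nonneg fun ω => by positivity), mul_pow,
    Real.sq_sqrt (by positivity)] at h1
  rw [one_div, ← div_eq_inv_mul, div_le_iff₀ (by positivity)]
  linarith

/-- The moments of an admissible measure agree with those of the true measure up to the noise
level amplified by the least singular value of the multipole matrix. -/
theorem abs_moment_sub_le {N : ℕ} {R h : ℝ} (hh : 0 < h) (hhpi : h ≤ Real.pi) {d σ M : ℝ}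
    (hd : 0 ≤ d) (hσ : 0 ≤ σ) (hM0 : 0 < M) {n : ℕ} {a y aStar yStar : Fin n → ℝ}
    (hyStar : ∀ j, |yStar j| ≤ d) (hM : tvNorm aStar ≤ M) {w : ℝ → ℂ}
    (hw : IsNoiseSpectrum σ w)
    (hadm : IsAdmissible R h d σ M (measurement R h N aStar yStar w) a y) {s : ℕ}
    (hs : d ^ s / ((s.factorial : ℝ) * √(2 * (s : ℝ) + 1)) ≤
      σ / (2 * Real.exp d * √Real.pi * M))
    (hsmin : 0 < sigmaMin R h N s) {r : ℕ} (hr : r < s) :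
    |∑ j, a j * y j ^ r - ∑ j, aStar j * yStar j ^ r| ≤
      r.factorial * √(2 * (r : ℝ) + 1) * (3 * σ / sigmaMin R h N s) := by
  set b : Fin n ⊕ Fin n → ℝ := Sum.elim a fun j => -aStar j with hb
  set z : Fin n ⊕ Fin n → ℝ := Sum.elim y yStar with hz
  -- Dividing by `√(2r + 1)` undoes the column scaling, so the matrix maps `v` to the truncated
  -- expansion `C - τ`, scaled by `√h`.
  set v : Fin s → ℝ := fun r => (∑ j, b j * (-z j) ^ (r : ℕ)) / (r : ℕ).factorial /
    √(2 * ((r : ℕ) : ℝ) + 1) with hv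
  set C : EuclideanSpace ℝ (Fin N) :=
    WithLp.toLp 2 fun t => ∑ j, b j * Real.sinc (samplePoint R h t - z j) with hC
  set τ : EuclideanSpace ℝ (Fin N) := WithLp.toLp 2 fun t =>
    ∑ j, b j * Real.sinc (samplePoint R h t - z j) - ∑ r ∈ Finset.range s,
      (∑ j, b j * (-z j) ^ r) / r.factorial *
        iteratedDeriv r Real.sinc (samplePoint R h t) with hτ
  have hzd : ∀ j, |z j| ≤ d := by
    rintro (j | j)
    · exact abs_le.mpr (hadm.support_subset j)
    · exact hyStar j
  have hbA : ∑ j, |b j| ≤ 2 * M := by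
    have h1 := hadm.tvNorm_le
    simp only [tvNorm] at h1 hM
    simp only [hb, Fintype.sum_sum_type, Sum.elim_inl, Sum.elim_inr, abs_neg]
    linarith
  have hTv : Matrix.toEuclideanLin (√h • multipoleMatrix R h N s) (WithLp.toLp 2 v) =
      √h • (C - τ) := by
    ext t
    rw [toEuclideanLin_multipoleMatrix_apply]
    simp only [PiLp.smul_apply, PiLp.sub_apply, hC, hτ, smul_eq_mul, sub_sub_cancel]
    rw [← Fin.sum_univ_eq_sum_range (fun r => (∑ j, b j * (-z j) ^ r) / r.factorial *
        iteratedDeriv r Real.sinc (samplePoint R h t))]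
    congr 1
    refine Finset.sum_congr rfl fun r _ => ?_
    have : √(2 * ((r : ℕ) : ℝ) + 1) ≠ 0 := by positivity
    simp only [hv]
    field_simp
  -- The total mass `2M` matches the factor `2` in the threshold defining `sStar`.
  have hτσ : √h * ‖τ‖ ≤ σ := by
    refine (sqrt_mul_norm_le_of_sq hh.le (K := 2 * M * Real.exp d * √Real.pi *
      (d ^ s / (s.factorial * √(2 * s + 1)))) (by positivity) τ ?_).trans ?_
    · simpa [hτ] using mul_sum_multipole_tail_sq_le (N := N) (R := R) hh hhpi s hd hzd hbA
    · rw [le_div_iff₀ (by positivity)] at hs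
      calc _ = d ^ s / (s.factorial * √(2 * s + 1)) * (2 * Real.exp d * √Real.pi * M) := by ring
        _ ≤ σ := hs
  -- One `σ` from the admissibility residual, one from the noise.
  have hCσ : √h * ‖C‖ ≤ 2 * σ := by
    have h1 : ‖C‖ = ‖(WithLp.toLp 2 fun t => ((C t : ℝ) : ℂ) : EuclideanSpace ℂ (Fin N))‖ := by
      simp [EuclideanSpace.norm_eq]
    have h2 : (WithLp.toLp 2 fun t => ((C t : ℝ) : ℂ) : EuclideanSpace ℂ (Fin N)) =
        (imageVec R h N a y - measurement R h N aStar yStar w) +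
          WithLp.toLp 2 fun t => noise w (samplePoint R h t) := by
      ext t
      simp [hC, hb, hz, imageVec, measurement, convPSF, Fintype.sum_sum_type]
      ring
    rw [h1, h2]
    have h3 := hadm.residual_le
    have h4 := sqrt_mul_norm_noise_le (N := N) (R := R) hh hhpi hσ hw
    have h5 := mul_le_mul_of_nonneg_left (norm_add_le
      (imageVec R h N a y - measurement R h N aStar yStar w)
      (WithLp.toLp 2 fun t => noise w (samplePoint R h t))) (Real.sqrt_nonneg h)
    linarith
  have hvη : ‖(WithLp.toLp 2 v : EuclideanSpace ℝ (Fin s))‖ ≤ 3 * σ / sigmaMin R h N s := by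
    rw [le_div_iff₀ hsmin, mul_comm]
    refine (sigmaMin_mul_norm_le R h N s (WithLp.toLp 2 v)).trans ?_
    rw [hTv, norm_smul, Real.norm_of_nonneg (Real.sqrt_nonneg h)]
    have := mul_le_mul_of_nonneg_left (norm_sub_le C τ) (Real.sqrt_nonneg h)
    linarith
  have hvr : |v ⟨r, hr⟩| ≤ 3 * σ / sigmaMin R h N s :=
    (PiLp.norm_apply_le (WithLp.toLp 2 v : EuclideanSpace ℝ (Fin s)) ⟨r, hr⟩).trans hvη
  have hmom : |∑ j, b j * (-z j) ^ r| = |∑ j, a j * y j ^ r - ∑ j, aStar j * yStar j ^ r| := by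
    have : ∑ j, b j * (-z j) ^ r =
        (-1) ^ r * (∑ j, a j * y j ^ r - ∑ j, aStar j * yStar j ^ r) := by
      simp only [hb, hz, Fintype.sum_sum_type, Sum.elim_inl, Sum.elim_inr]
      rw [mul_sub, Finset.mul_sum, Finset.mul_sum, sub_eq_add_neg, ← Finset.sum_neg_distrib]
      refine congrArg₂ (· + ·) (Finset.sum_congr rfl fun j _ => ?_)
        (Finset.sum_congr rfl fun j _ => ?_)
      · rw [neg_pow (y j)]
        ring
      · rw [neg_pow (yStar j)]
        ring
    rw [this, abs_mul, abs_pow, abs_neg, abs_one, one_pow, one_mul]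
  have h6 : (0 : ℝ) < √(2 * (r : ℝ) + 1) := by positivity
  have h7 : (0 : ℝ) < r.factorial := by positivity
  simp only [hv] at hvr
  rw [abs_div, abs_div, abs_of_pos h6, abs_of_pos h7, hmom, div_div, div_le_iff₀ (by positivity)]
    at hvr
  linarith

/-! ### Enough multipoles -/

/-- Under the separation condition, the number of multipoles is at least `2n`. -/
theorem two_mul_le_of_separation {n s : ℕ} (hn : 2 ≤ n) {d D m M σ ς : ℝ} (hd : 0 < d)
    (hD : 0 < D) (hDd : (n - 1) * D ≤ 2 * d) (hm : 0 < m) (hmM : n * m ≤ M) (hς : 0 < ς)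
    (hςpi : ς ≤ √Real.pi)
    (hsep : 3 * σ / ς / m ≤ (D / (6.24 * (1 + d))) ^ (2 * n - 1))
    (hs : d ^ s / ((s.factorial : ℝ) * √(2 * (s : ℝ) + 1)) ≤
      σ / (2 * Real.exp d * √Real.pi * M)) : 2 * n ≤ s := by
  by_contra hcon
  push Not at hcon
  obtain ⟨k, hk⟩ : ∃ k, 2 * n - 1 = k := ⟨_, rfl⟩
  rw [hk] at hsep
  have hsk : s ≤ k := by omega
  have hkn : (k : ℝ) = 2 * n - 1 := by
    rw [← hk, Nat.cast_sub (by omega)]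
    push_cast
    ring
  have hn2 : (2 : ℝ) ≤ n := by exact_mod_cast hn
  have hk0 : (0 : ℝ) < k := by rw [hkn]; linarith
  have hM0 : 0 < M := lt_of_lt_of_le (by positivity) hmM
  have hspi : 0 < √Real.pi := Real.sqrt_pos.mpr Real.pi_pos
  -- From `(n - 1) D ≤ 2d` and `2n - 1 ≤ 3(n - 1)` follows `(2n - 1) D ≤ 6d`.
  have hX : D / (6.24 * (1 + d)) ≤ d / (1 + d) / k := by
    rw [div_div, div_le_div_iff₀ (by positivity) (by positivity)]
    have h1 : D * k ≤ 6.24 * d := by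
      rw [hkn]
      nlinarith
    nlinarith
  have hfrac : (d / (1 + d)) ^ k ≤ d ^ s := by
    calc (d / (1 + d)) ^ k ≤ (d / (1 + d)) ^ s :=
          pow_le_pow_of_le_one (by positivity) (by rw [div_le_one (by positivity)]; linarith) hsk
      _ ≤ d ^ s := by
          gcongr
          exact div_le_self hd.le (by linarith)
  have hupper : 3 * σ ≤ √Real.pi * m * (d ^ s / k ^ k) := by
    have h1 : 3 * σ / ς / m ≤ d ^ s / k ^ k := by
      calc _ ≤ _ := hsep
        _ ≤ (d / (1 + d) / k) ^ k := by gcongr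
        _ = (d / (1 + d)) ^ k / k ^ k := div_pow _ _ _
        _ ≤ _ := by gcongr
    rw [div_div, div_le_iff₀ (by positivity)] at h1
    calc 3 * σ ≤ d ^ s / k ^ k * (ς * m) := h1
      _ ≤ d ^ s / k ^ k * (√Real.pi * m) := by gcongr
      _ = _ := by ring
  -- If `s < 2n`, the threshold bounds `σ` below by the positive quantity that bounds `3σ` above.
  -- The `n` in `n * m ≤ M` cancels the one in `√(2s + 1) ≤ 2n`.
  have hlower : 2 * √Real.pi * (n * m) * (d ^ s / (k ^ k * (2 * n))) ≤ σ := by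
    rw [le_div_iff₀ (by positivity)] at hs
    have hfac : (s.factorial : ℝ) * √(2 * (s : ℝ) + 1) ≤ k ^ k * (2 * n) := by
      have h1 : (s.factorial : ℝ) ≤ k ^ k := by
        exact_mod_cast (Nat.factorial_le hsk).trans (Nat.factorial_le_pow k)
      have h2 : √(2 * (s : ℝ) + 1) ≤ 2 * n := by
        rw [Real.sqrt_le_left (by positivity)]
        have : (s : ℝ) ≤ k := by exact_mod_cast hsk
        rw [hkn] at this
        nlinarith
      exact mul_le_mul h1 h2 (Real.sqrt_nonneg _) (by positivity)
    have hexp : 1 ≤ Real.exp d := Real.one_le_exp hd.le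
    calc _ ≤ 2 * √Real.pi * M * (d ^ s / (s.factorial * √(2 * (s : ℝ) + 1))) := by gcongr
      _ ≤ Real.exp d * (2 * √Real.pi * M * (d ^ s / (s.factorial * √(2 * (s : ℝ) + 1)))) :=
          le_mul_of_one_le_left (by positivity) hexp
      _ = d ^ s / (s.factorial * √(2 * (s : ℝ) + 1)) * (2 * Real.exp d * √Real.pi * M) := by ring
      _ ≤ σ := hs
  have hpos : 0 < √Real.pi * m * (d ^ s / k ^ k) := by positivity
  have heq : 2 * √Real.pi * (n * m) * (d ^ s / (k ^ k * (2 * n))) =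
      √Real.pi * m * (d ^ s / k ^ k) := by
    have : (n : ℝ) ≠ 0 := by positivity
    field_simp
  linarith

/-! ### The stated constant and the conclusion -/

/-- Here `15.46 = 2 * 7.73`: this is the comparison of the proved factor `1 / 2` with `7.73 / (e
π^{3/2})`, and it makes the rate strict. -/
theorem exp_one_mul_pi_rpow_lt : Real.exp 1 * Real.pi ^ (3 / 2 : ℝ) < 15.46 := by
  have hpi := Real.pi_pos
  have h1 : Real.pi ^ (3 / 2 : ℝ) = Real.pi * √Real.pi := by
    rw [Real.sqrt_eq_rpow, show (3 / 2 : ℝ) = 1 + 1 / 2 by norm_num, Real.rpow_add hpi,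
      Real.rpow_one]
  have h2 : √Real.pi ≤ 1.78 := by
    rw [Real.sqrt_le_left (by norm_num)]
    linarith [Real.pi_lt_d2]
  have h3 := Real.exp_one_lt_d9
  have h4 : Real.pi ≤ 3.15 := Real.pi_lt_d2.le
  rw [h1]
  calc Real.exp 1 * (Real.pi * √Real.pi) ≤ 2.7182818286 * (3.15 * 1.78) := by gcongr
    _ < 15.46 := by norm_num

/-- The rate with the constant of the node-polynomial bound is below the rate with the stated
constant. -/
theorem lt_stabConst_mul {n : ℕ} (hn : 2 ≤ n) {d D q δ : ℝ} (hd : 0 ≤ d) (hD : 0 < D)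
    (hq : 0 < q)
    (hδ : δ * D ^ (2 * n - 2) ≤
      (1 + d) ^ (2 * n - 1) * ((2 * n - 1) * √(4 * (n : ℝ) - 1) * q) * 4 ^ (2 * n - 2) / 2) :
    δ < stabConst n d * (Real.pi / D) ^ (2 * n - 2) * q := by
  have hpi := Real.pi_pos
  have hn2 : (2 : ℝ) ≤ n := by exact_mod_cast hn
  have hsq : 0 < √(4 * (n : ℝ) - 1) := Real.sqrt_pos.mpr (by linarith)
  have hk : (0 : ℝ) < 2 * n - 1 := by linarith
  set c := Real.exp 1 * Real.pi ^ (3 / 2 : ℝ)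
  have hc0 : 0 < c := by positivity
  have hrpow : Real.pi ^ (2 * (n : ℝ) - 1 / 2) =
      Real.pi ^ (2 * n - 2) * Real.pi ^ (3 / 2 : ℝ) := by
    rw [← Real.rpow_natCast, ← Real.rpow_add hpi, Nat.cast_sub (by omega)]
    congr 1
    push_cast
    ring
  have heq : stabConst n d * (Real.pi / D) ^ (2 * n - 2) * q =
      (1 + d) ^ (2 * n - 1) * ((2 * n - 1) * √(4 * (n : ℝ) - 1) * q) * 4 ^ (2 * n - 2) *
        (7.73 / c) / D ^ (2 * n - 2) := by
    rw [stabConst, hrpow, show 4 + 4 * d = 4 * (1 + d) by ring, mul_pow 4 (1 + d),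
      show (4 : ℝ) ^ (2 * n - 1) = 4 ^ (2 * n - 2) * 4 by
        rw [← pow_succ]; congr 1; omega, div_pow]
    simp only [c]
    have := (Real.rpow_pos_of_pos hpi (3 / 2 : ℝ)).ne'
    field_simp
  rw [heq, lt_div_iff₀ (by positivity)]
  refine hδ.trans_lt ?_
  rw [div_eq_mul_inv]
  refine mul_lt_mul_of_pos_left ?_ (by positivity)
  rw [lt_div_iff₀ hc0]
  linarith [exp_one_mul_pi_rpow_lt]

end Deconvolution

theorem theorem4p1
    -- sampling: `N` points `-R, -R + h, …, R` with spacing `h ≤ π`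
    (N : ℕ) (R h : ℝ) (hR : 0 < R) (hh : 0 < h) (hhpi : h ≤ Real.pi)
    (hgrid : -R + ((N : ℝ) - 1) * h = R)
    -- interval size, noise level and a priori bound
    (d σ M : ℝ) (hσ : 0 < σ)
    -- the true measure
    (n : ℕ) (hn : 2 ≤ n) (aStar yStar : Fin n → ℝ)
    (haStar : ∀ j, aStar j ≠ 0)
    (hyStar : StrictMono yStar) (hyStar_mem : ∀ j, yStar j ∈ Set.Icc (-d) d)
    (hM : tvNorm aStar ≤ M)
    -- the noise
    (w : ℝ → ℂ) (hw : IsNoiseSpectrum σ w)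
    -- the separation condition
    (hsmin : 0 < sigmaMin R h N (sStar d σ M))
    (hsep : 6.24 * (1 + d) *
        (3 / sigmaMin R h N (sStar d σ M) * (σ / minAmp aStar)) ^ (1 / (2 * (n : ℝ) - 1))
      ≤ minSep yStar)
    -- an admissible measure with ordered support
    (a y : Fin n → ℝ) (hy : StrictMono y)
    (hadm : IsAdmissible R h d σ M (measurement R h N aStar yStar w) a y) :
    (∀ i, |y i - yStar i| < minSep yStar / 2) ∧
    (∀ i, |y i - yStar i| <
      stabConst n d * SRF yStar ^ (2 * n - 2) *
        (3 * σ / (sigmaMin R h N (sStar d σ M) * minAmp aStar))) := by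
  have hm := minAmp_pos (by omega) haStar
  have hD := minSep_pos hn hyStar.injective
  have hDle : ∀ i j, i ≠ j → minSep yStar ≤ |yStar i - yStar j| :=
    fun i j hij => minSep_le_abs_sub yStar hij
  have hs0 := pos_of_sigmaMin_pos hsmin
  -- `sInf ∅ = 0` in `ℕ`, so a positive `sStar` is attained.
  have hs : d ^ sStar d σ M / (((sStar d σ M).factorial : ℝ) * √(2 * (sStar d σ M : ℝ) + 1)) ≤
      σ / (2 * Real.exp d * √Real.pi * M) := Nat.sInf_mem (Nat.nonempty_of_pos_sInf hs0)
  have hn2 : (2 : ℝ) ≤ n := by exact_mod_cast hn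
  have hDd : (n - 1) * minSep yStar ≤ 2 * d := by
    have h1 := mul_sub_le_of_le_abs_sub hyStar hDle
      (i := ⟨0, by omega⟩) (j := ⟨n - 1, by omega⟩) (by simp)
    have h2 := (hyStar_mem ⟨n - 1, by omega⟩).2
    have h3 := (hyStar_mem ⟨0, by omega⟩).1
    simp only [Nat.cast_zero, sub_zero] at h1
    rw [Nat.cast_sub (by omega), Nat.cast_one] at h1
    linarith
  -- Two distinct atoms in `[-d, d]` force this.
  have hd : 0 < d := by nlinarith
  have hmM : n * minAmp aStar ≤ M := (card_mul_minAmp_le_tvNorm aStar).trans hM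
  have hM0 : 0 < M := lt_of_lt_of_le (by positivity) hmM
  set ς := sigmaMin R h N (sStar d σ M)
  set q := 3 * σ / ς / minAmp aStar with hq
  have hq0 : 0 < q := by positivity
  have hsep' : q ≤ (minSep yStar / (6.24 * (1 + d))) ^ (2 * n - 1) := by
    have h1 : 3 / ς * (σ / minAmp aStar) = q := by
      rw [hq]
      field_simp
    have h2 : 1 / (2 * (n : ℝ) - 1) = (((2 * n - 1 : ℕ) : ℝ))⁻¹ := by
      rw [Nat.cast_sub (by omega), one_div]
      push_cast
      rfl
    rw [h1, h2, mul_comm, ← le_div_iff₀ (by positivity)] at hsep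
    calc q = (q ^ (((2 * n - 1 : ℕ) : ℝ))⁻¹) ^ (2 * n - 1) :=
          (Real.rpow_inv_natCast_pow hq0.le (by omega)).symm
      _ ≤ _ := pow_le_pow_left₀ (by positivity) hsep _
  have h2n := two_mul_le_of_separation hn hd hD hDd hm hmM hsmin
    (sigmaMin_le_sqrt_pi hh hhpi hs0) hsep' hs
  have hyStard : ∀ j, |yStar j| ≤ d := fun j => abs_le.mpr (hyStar_mem j)
  have hmom : ∀ r ≤ 2 * n - 1, |∑ j, a j * y j ^ r - ∑ j, aStar j * yStar j ^ r| ≤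
      (2 * n - 1).factorial * √(4 * (n : ℝ) - 1) * (3 * σ / ς) := by
    intro r hr
    refine (abs_moment_sub_le hh hhpi hd.le hσ.le hM0 hyStard hM hw hadm hs hsmin
      (r := r) (by omega)).trans ?_
    have h1 : (r.factorial : ℝ) ≤ (2 * n - 1).factorial := by
      exact_mod_cast Nat.factorial_le hr
    have h2 : √(2 * (r : ℝ) + 1) ≤ √(4 * (n : ℝ) - 1) := by
      refine Real.sqrt_le_sqrt ?_
      have : (r : ℝ) ≤ ((2 * n - 1 : ℕ) : ℝ) := by exact_mod_cast hr
      rw [Nat.cast_sub (by omega)] at this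
      push_cast at this
      linarith
    gcongr
  obtain ⟨hnear, hrate⟩ := near_of_moments hn hyStar hy hd.le hD hDle hm
    (minAmp_le_abs aStar) (η := 3 * σ / ς) (by positivity)
    (fun j => abs_le.mpr (hadm.support_subset j)) hyStard hmom hsep'
  refine ⟨hnear, fun i => ?_⟩
  have := lt_stabConst_mul hn hd.le hD hq0 (hrate i)
  rwa [hq, div_div] at this
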